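/- Let $T,N\ge 1$ and $D\ge 0$ be integers, $\mathcal X=\mathbb R^D$, $\kappa\in\{0,1\}$ and $\delta_1,\dots,\delta_T>0$. Write $[N]_0=\{0,\dots,N\}$, let $\mathrm N(x;m,C)$ be the density of the Gaussian law $\mathrm N(m,C)$ at $x$, and let quantities with time index $0$ be ignored. For $t\le T$ let $$Q_t(x_{t-1},x_t)=M_t(x_t\mid x_{t-1})\,G_t(x_{t-1},x_t),\qquad M_t(x_t\mid x_{t-1})=\mathrm N(x_t;m_t(x_{t-1}),C_t),$$ where the $C_t$ are constant symmetric positive definite matrices, the $m_t$ are measurable ($m_1$ is a vector), and $G_t>0$ is measurable and differentiable in $x_t$. Assume $0<\int\prod_tQ_t(x_{t-1},x_t)\,dx_{1:T}<\infty$, and let $\pi_T$ be the probability measure on $\mathcal X^T$ with density proportional to $\prod_{t=1}^TQ_t(x_{t-1},x_t)$. Put $A_t=(C_t+\tfrac{\delta_t}2I)^{-1}C_t$, $\;v_t(x)=(I-A_t)m_t(x)$, $\;\phi_t(x_{t-1},x_t)=\kappa\tfrac{\delta_t}2\nabla_{x_t}\log G_t(x_{t-1},x_t)$, $\;\Gamma_t=\tfrac2{\delta_t}(I+NA_t)^{-1}$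 and $$\log H_{t,\phi}(x,v,\bar x,\bar v)=\tfrac12(x-v)^\top\bigl((\tfrac{\delta_t}2A_t)^{-1}+\Gamma_t\bigr)(x-v)-\bigl[\tfrac N2(x+\phi)^\top A_t+(x-v)^\top\bigr]\Gamma_t(x+\phi)+(N+1)(\bar x-\bar v)^\top\Gamma_t(v+\phi).$$ **Particle-mGRAD.** Given $x_{1:T}\in\mathcal X^T$: 1. For $t=1,\dots,T$: (a) sample $k_t$ uniformly on $[N]_0$ and set $x_t^{k_t}=x_t$; (b) if $t>1$, set $a_{t-1}^{k_t}=k_{t-1}$ and, for $n\ne k_t$, sample $a_{t-1}^n=i$ with probability $W_{t-1}^i$; (c) sample $u_t\sim\mathrm N(x_t+\phi_t(x_{t-1},x_t),\tfrac{\delta_t}2I)$ and, for $n\neq k_t$, independently $x_t^n\sim\mathrm N\bigl(m_t^n+A_t(u_t-m_t^n),(I-A_t)C_t\bigr)$, where $m_t^n=m_t(x_{t-1}^{a_{t-1}^n})$; (d) with $v_t^n=v_t(x_{t-1}^{a_{t-1}^n})$, with $\bar x_t,\bar v_t$ the averages of $x_t^n,v_t^n$ over $n\in[N]_0$, and with $\phi_t^n=\phi_t(x_{t-1}^{a_{t-1}^n},x_t^n)$,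 set $$w_t^n=Q_t(x_{t-1}^{a_{t-1}^n},x_t^n)\,H_{t,\phi_t^n}(x_t^n,v_t^n,\bar x_t,\bar v_t),\qquad W_t^n=w_t^n/\textstyle\sum_mw_t^m .$$ 2. Sample $i\ne k_T$ with probability $W_T^i/(1-W_T^{k_T})$; set $l_T=i$ with probability $1\wedge\frac{1-W_T^{k_T}}{1-W_T^i}$, otherwise $l_T=k_T$. 3. For $t=T-1,\dots,1$, sample $l_t=i$ with probability proportional to $W_t^iQ_{t+1}(x_t^i,x_{t+1}^{l_{t+1}})$. 4. Return $\tilde x_{1:T}=(x_1^{l_1},\dots,x_T^{l_T})$. **Generic marginal algorithm** with matrices $H_t,D_t,E_t$ and functions $v_t,\phi_t$: the same steps, except that in (c) one samples $x_t^{-k_t}=(x_t^n)_{n\ne k_t}$ from $q_t^{-k_t}(\cdot\mid x_t^{k_t})$ and in (d) uses the weights $Q_t(x_{t-1}^{a_{t-1}^n},x_t^n)\,q_t^{-n}(x_t^{-n}\mid x_t^n)$, where, given the particles at time $t-1$ and the ancestor indices $a_{t-1}^{0:N}$, $$q_t^{-n}(x_t^{-n}\mid x_t^n)=\int\mathrm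 N\bigl(u;x_t^n+\phi_t(x_{t-1}^{a_{t-1}^n},x_t^n),E_t\bigr)\prod_{m\ne n}\mathrm N\bigl(x_t^m;v_t(x_{t-1}^{a_{t-1}^m})+H_tu,D_t\bigr)\,du .$$ **Proposition.** Sampling $\tilde x_{1:T}$ given $x_{1:T}$ by Particle-mGRAD induces a Markov kernel on $\mathcal X^T$ which leaves $\pi_T$ invariant. Moreover, Particle-mGRAD is the special case $H_t=A_t$, $D_t=\tfrac{\delta_t}2A_t$, $E_t=\tfrac{\delta_t}2I$ (with the above $v_t$, $\phi_t$) of the generic marginal algorithm: the proposal densities coincide, the weights coincide up to a positive factor that does not depend on the particle index $n$, and hence the two algorithms induce the same kernel. -/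

import Mathlib

open MeasureTheory ProbabilityTheory Matrix

namespace ParticleMGRAD

/-- The state space `ℝ^D`. Only its Borel structure, its topology, Lebesgue measure and the
coordinates are used, never a norm. -/
abbrev State (D : ℕ) : Type := Fin D → ℝ

/-- Paths `x_{1:T}` with `T = S + 1` time steps; time `t ∈ {1, …, T}` is the index `t - 1`. -/
abbrev Path (S D : ℕ) : Type := Fin (S + 1) → State D

/-- The tuple `(x^0, …, x^N)` of all `N + 1` particles at one time. -/
abbrev Particles (N D : ℕ) : Type := Fin (N + 1) → State D

/-- Lebesgue density at `x` of the Gaussian with mean `m` and covariance matrix `C`. -/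
noncomputable def gaussDensity {D : ℕ} (m : State D) (C : Matrix (Fin D) (Fin D) ℝ)
    (x : State D) : ℝ :=
  (Real.sqrt ((2 * Real.pi) ^ D * C.det))⁻¹ *
    Real.exp (-(1 / 2) * ((x - m) ⬝ᵥ (C⁻¹ *ᵥ (x - m))))

/-- The gradient, as the vector of partial derivatives. -/
noncomputable def grad {D : ℕ} (f : State D → ℝ) (x : State D) : State D :=
  fun j => fderiv ℝ f x (Pi.single j 1)

/-- The state preceding time `t` on a path. Nothing precedes the first time, so the value there is
a dummy, which the models below ignore. -/
def prevState {S D : ℕ} (x : Path S D) (t : Fin (S + 1)) : State D :=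
  Fin.cases 0 (fun s => x s.castSucc) t

/-! ### Feynman-Kac models with Gaussian mutations of constant covariance -/

/-- The data of a model with mutation densities `M_1 = N(m₁, C_1)`, `M_t(· | x) = N(m_t(x), C_t)`
and potentials `G_1(x_1)`, `G_t(x_{t-1}, x_t)`. The functions `m s`, `G s` belong to the time
with index `s.succ`. -/
structure Model (S D : ℕ) where
  m₁ : State D
  m : Fin S → State D → State D
  C : Fin (S + 1) → Matrix (Fin D) (Fin D) ℝ
  G₁ : State D → ℝ
  G : Fin S → State D → State D → ℝ

namespace Model

variable {S D : ℕ} (𝓜 : Model S D)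

/-- The mutation mean `m_t(x_{t-1})`; the argument is ignored at the first time. -/
def mean (t : Fin (S + 1)) : State D → State D :=
  Fin.cases (fun _ => 𝓜.m₁) 𝓜.m t

/-- The potential `G_t(x_{t-1}, x_t)`; the first argument is ignored at the first time. -/
def pot (t : Fin (S + 1)) : State D → State D → ℝ :=
  Fin.cases (fun _ => 𝓜.G₁) 𝓜.G t

/-- `Q_t(x_{t-1}, x_t) = M_t(x_t | x_{t-1}) G_t(x_{t-1}, x_t)`. -/
noncomputable def Q (t : Fin (S + 1)) (xp x : State D) : ℝ :=
  gaussDensity (𝓜.mean t xp) (𝓜.C t) x * 𝓜.pot t xp x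

/-- The unnormalised target density `∏_t Q_t(x_{t-1}, x_t)`. -/
noncomputable def targetDensity (x : Path S D) : ℝ :=
  ∏ t, 𝓜.Q t (prevState x t) (x t)

/-- The normalising constant of the target. -/
noncomputable def normConst : ENNReal :=
  ∫⁻ x : Path S D, ENNReal.ofReal (𝓜.targetDensity x)

/-- The joint smoothing distribution `π_T`. -/
noncomputable def target : Measure (Path S D) :=
  (𝓜.normConst)⁻¹ • (volume.withDensity fun x => ENNReal.ofReal (𝓜.targetDensity x))

end Model

/-! ### Conditional SMC with general proposals and weights

In this section a proposal is a function `prop t k y z`: the density, at the particles `z^n`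
with `n ≠ k`, of the proposal at time `t` when the reference particle has index `k` and value `z^k`
and the ancestor of particle `n` has the value `y n`. A weight function is a function `w t y z n`:
the unnormalised weight of particle `n` at time `t`. -/

section CSMC

variable {S N D : ℕ}

/-- The values `x_{t-1}^{a_{t-1}^n}` of the ancestors of the particles at time `t`, where `a s n` is
the ancestor index of particle `n` at time `s.succ` (a dummy at the first time). -/
def ancestors (a : Fin S → Fin (N + 1) → Fin (N + 1)) (z : Fin (S + 1) → Particles N D)
    (t : Fin (S + 1)) : Particles N D :=
  Fin.cases (fun _ => 0) (fun s n => z s.castSucc (a s n)) t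

/-- The normalised weights `W^n = w^n / ∑_m w^m`. -/
noncomputable def normalise (w : Fin (N + 1) → ℝ) (n : Fin (N + 1)) : ℝ :=
  w n / ∑ m, w m

/-- The probability of moving from index `k` to index `l` in the forced-move step: draw `i ≠ k` with
probability `W^i / (1 - W^k)`; move to `i` with probability `1 ∧ (1 - W^k) / (1 - W^i)`, and
otherwise stay at `k`. -/
noncomputable def forcedMove (W : Fin (N + 1) → ℝ) (k l : Fin (N + 1)) : ℝ :=
  ∑ i ∈ Finset.univ.erase k, W i / (1 - W k) *
    ((if l = i then min 1 ((1 - W k) / (1 - W i)) else 0) +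
      (if l = k then 1 - min 1 ((1 - W k) / (1 - W i)) else 0))

/-- The joint density of all variables generated by the algorithm, as the product over its steps:
the reference indices `k_t` are uniform; the particles are drawn from the proposal; the ancestor of
the reference particle is the previous reference particle and the other ancestors are drawn from the
normalised weights; the last output index is drawn by the forced move; the earlier ones are drawn by
backward sampling. -/
noncomputable def jointDensity (Q : Fin (S + 1) → State D → State D → ℝ)
    (prop : Fin (S + 1) → Fin (N + 1) → Particles N D → Particles N D → ℝ)
    (w : Fin (S + 1) → Particles N D → Particles N D → Fin (N + 1) → ℝ)
    (k : Fin (S + 1) → Fin (N + 1)) (a : Fin S → Fin (N + 1) → Fin (N + 1))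
    (l : Fin (S + 1) → Fin (N + 1)) (z : Fin (S + 1) → Particles N D) : ℝ :=
  let W : Fin (S + 1) → Fin (N + 1) → ℝ := fun t => normalise (w t (ancestors a z t) (z t))
  (∏ t, 1 / ((N : ℝ) + 1) * prop t (k t) (ancestors a z t) (z t)) *
  (∏ s : Fin S, (if a s (k s.succ) = k s.castSucc then 1 else 0) *
    ∏ n ∈ Finset.univ.erase (k s.succ), W s.castSucc (a s n)) *
  forcedMove (W (Fin.last S)) (k (Fin.last S)) (l (Fin.last S)) *
  ∏ s : Fin S,
    (W s.castSucc (l s.castSucc) *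
        Q s.succ (z s.castSucc (l s.castSucc)) (z s.succ (l s.succ))) /
      ∑ n, W s.castSucc n * Q s.succ (z s.castSucc n) (z s.succ (l s.succ))

/-- The measure, on arrays of particles, with respect to which `jointDensity` is a density: particle
`k_t` at time `t` is set to the reference state `x_t`, all others are continuous. -/
noncomputable def particleMeasure (x : Path S D) (k : Fin (S + 1) → Fin (N + 1)) :
    Measure (Fin (S + 1) → Particles N D) :=
  Measure.pi fun t => Measure.pi fun n =>
    if n = k t then Measure.dirac (x t) else volume

/-- The law of the output path `(z_1^{l_1}, …, z_T^{l_T})` of the algorithm started at the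
reference path `x`. -/
noncomputable def csmcLaw (Q : Fin (S + 1) → State D → State D → ℝ)
    (prop : Fin (S + 1) → Fin (N + 1) → Particles N D → Particles N D → ℝ)
    (w : Fin (S + 1) → Particles N D → Particles N D → Fin (N + 1) → ℝ)
    (x : Path S D) : Measure (Path S D) :=
  ∑ k : Fin (S + 1) → Fin (N + 1), ∑ a : Fin S → Fin (N + 1) → Fin (N + 1),
    ∑ l : Fin (S + 1) → Fin (N + 1),
      ((particleMeasure x k).withDensity fun z =>
        ENNReal.ofReal (jointDensity Q prop w k a l z)).map fun z t => z t (l t)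

end CSMC

/-! ### The generic marginal algorithm -/

section Generic

variable {S N D : ℕ}

/-- `q_t^{-k}(z^{-k} | z^k)`: the density of the particles other than `k` when
`u ~ N(z^k + φ_t(y^k, z^k), E_t)` and `z^n ~ N(v_t(y^n) + H_t u, D_t)` for `n ≠ k`. -/
noncomputable def genericProposal (φ : Fin (S + 1) → State D → State D → State D)
    (v : Fin (S + 1) → State D → State D) (H Dm E : Fin (S + 1) → Matrix (Fin D) (Fin D) ℝ)
    (t : Fin (S + 1)) (k : Fin (N + 1)) (y z : Particles N D) : ℝ :=
  ∫ u : State D, gaussDensity (z k + φ t (y k) (z k)) (E t) u *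
    ∏ n ∈ Finset.univ.erase k, gaussDensity (v t (y n) + H t *ᵥ u) (Dm t) (z n)

/-- The weights `Q_t(y^n, z^n) q_t^{-n}(z^{-n} | z^n)`. -/
noncomputable def genericWeight (Q : Fin (S + 1) → State D → State D → ℝ)
    (φ : Fin (S + 1) → State D → State D → State D)
    (v : Fin (S + 1) → State D → State D) (H Dm E : Fin (S + 1) → Matrix (Fin D) (Fin D) ℝ)
    (t : Fin (S + 1)) (y z : Particles N D) (n : Fin (N + 1)) : ℝ :=
  Q t (y n) (z n) * genericProposal φ v H Dm E t n y z

/-- The law of the output of the generic marginal algorithm with `N + 1` particles. -/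
noncomputable def genericLaw (N : ℕ) (Q : Fin (S + 1) → State D → State D → ℝ)
    (φ : Fin (S + 1) → State D → State D → State D)
    (v : Fin (S + 1) → State D → State D) (H Dm E : Fin (S + 1) → Matrix (Fin D) (Fin D) ℝ)
    (x : Path S D) : Measure (Path S D) :=
  csmcLaw (N := N) Q (genericProposal φ v H Dm E) (genericWeight Q φ v H Dm E) x

end Generic

/-! ### The Particle-mGRAD algorithm -/

namespace Model

variable {S N D : ℕ} (𝓜 : Model S D) (κ : ℝ) (δ : Fin (S + 1) → ℝ)

/-- `A_t = (C_t + (δ_t / 2) I)⁻¹ C_t`. -/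
noncomputable def A (t : Fin (S + 1)) : Matrix (Fin D) (Fin D) ℝ :=
  (𝓜.C t + (δ t / 2) • (1 : Matrix (Fin D) (Fin D) ℝ))⁻¹ * 𝓜.C t

/-- `φ_t(x_{t-1}, x_t) = κ (δ_t / 2) ∇_{x_t} log G_t(x_{t-1}, x_t)`. -/
noncomputable def drift (t : Fin (S + 1)) (xp x : State D) : State D :=
  (κ * (δ t / 2)) • grad (fun x' => Real.log (𝓜.pot t xp x')) x

/-- `v_t(x_{t-1}) = (I - A_t) m_t(x_{t-1})`. -/
noncomputable def shift (t : Fin (S + 1)) (xp : State D) : State D :=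
  (1 - 𝓜.A δ t) *ᵥ 𝓜.mean t xp

/-- The density `N(m_t(x_{t-1}) + A_t (u - m_t(x_{t-1})), (I - A_t) C_t)` of a particle given
its ancestor and the auxiliary variable `u`. -/
noncomputable def auxMutation (t : Fin (S + 1)) (xp u x : State D) : ℝ :=
  gaussDensity (𝓜.mean t xp + 𝓜.A δ t *ᵥ (u - 𝓜.mean t xp)) ((1 - 𝓜.A δ t) * 𝓜.C t) x

/-- The Particle-mGRAD proposal: draw `u ~ N(z^k + φ_t(y^k, z^k), (δ_t / 2) I)`, where `z^k` is the
reference state at time `t` and its ancestor `y^k` the reference state at time `t - 1`, and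
then `z^n`, `n ≠ k`, independently from `auxMutation` given `u`. -/
noncomputable def mgradProposal (t : Fin (S + 1)) (k : Fin (N + 1)) (y z : Particles N D) : ℝ :=
  ∫ u : State D,
    gaussDensity (z k + 𝓜.drift κ δ t (y k) (z k))
        ((δ t / 2) • (1 : Matrix (Fin D) (Fin D) ℝ)) u *
      ∏ n ∈ Finset.univ.erase k, 𝓜.auxMutation δ t (y n) u (z n)

/-- The matrix `(2 / δ_t) (I + N A_t)⁻¹`. -/
noncomputable def weightMatrix (N : ℕ) (t : Fin (S + 1)) : Matrix (Fin D) (Fin D) ℝ :=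
  (2 / δ t) • (1 + (N : ℝ) • 𝓜.A δ t)⁻¹

/-- The logarithm of the weight factor `H_{t,φ}(x, v, x̄, v̄)`. -/
noncomputable def logWeightFactor (N : ℕ) (t : Fin (S + 1)) (φ x v xbar vbar : State D) : ℝ :=
  1 / 2 * ((x - v) ⬝ᵥ ((((δ t / 2) • 𝓜.A δ t)⁻¹ + 𝓜.weightMatrix δ N t) *ᵥ (x - v)))
  - ((N : ℝ) / 2 * ((x + φ) ⬝ᵥ ((𝓜.A δ t * 𝓜.weightMatrix δ N t) *ᵥ (x + φ)))
      + (x - v) ⬝ᵥ (𝓜.weightMatrix δ N t *ᵥ (x + φ)))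
  + ((N : ℝ) + 1) * ((xbar - vbar) ⬝ᵥ (𝓜.weightMatrix δ N t *ᵥ (v + φ)))

/-- The average of the particles. -/
noncomputable def average (z : Particles N D) : State D :=
  (1 / ((N : ℝ) + 1)) • ∑ n, z n

/-- The Particle-mGRAD weights. -/
noncomputable def mgradWeight (t : Fin (S + 1)) (y z : Particles N D) (n : Fin (N + 1)) : ℝ :=
  𝓜.Q t (y n) (z n) *
    Real.exp (𝓜.logWeightFactor δ N t (𝓜.drift κ δ t (y n) (z n)) (z n) (𝓜.shift δ t (y n))
      (average z) (average fun m => 𝓜.shift δ t (y m)))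

/-- The law of the output of the Particle-mGRAD algorithm with `N + 1` particles, given the
reference path `x`. -/
noncomputable def mgradLaw (N : ℕ) (x : Path S D) : Measure (Path S D) :=
  csmcLaw (N := N) 𝓜.Q (𝓜.mgradProposal κ δ) (𝓜.mgradWeight κ δ) x

end Model

end ParticleMGRAD

namespace ParticleMGRAD

/-! ### Gaussian densities: positivity, bounds, measurability, total mass. -/

section GaussianDensity

variable {D : ℕ}

/-! Invariance is proved for every `IsMarginalScheme`, that is, for positive `Q` and arbitrary
normalised proposal densities `q^{-k}`, with weights `w^n = Q · q^{-n}`. Give the reference path the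
unnormalised density `∏ Q_t`. When the reference indices follow ancestral lines, the product of
`Q_t` at the reference particle and `q_t^{-k_t}` is the weight of that particle, hence `(∑_m w_t^m)
W_t^{k_t}`. The factors `W_t^{k_t}` with `t < T` supply the ancestor probabilities missing for the
reference particles. So (`IsMarginalScheme.pathDensity_mul_forwardDensity`), conditionally on all
particles and ancestors, `k_T` has law `W_T` and the earlier `k_t` are its ancestral line.

The forced move is reversible with respect to `W_T`, so summing out the reference indices gives
`l_T` the law `W_T` (`IsMarginalScheme.sum_pathDensity_mul_jointDensity`). It remains to see that
the selected path has density `∏ Q_t` (`IsMarginalScheme.sum_lintegral_smoothingDensity`). This goes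
by induction on the number of time steps, removing the last one: the particles not selected
integrate out because `q^{-l}` has mass one, and the sum over the ancestor of the selected particle
is exactly the denominator of the backward sampling probability (`sum_lintegral_smoothing_step`).
What is left is `W^j Q`, the same situation one step earlier with a new test function. That the
output law has mass one is a parallel induction (`sum_lintegral_forwardDensity`).

For Particle-mGRAD, write `h = δ_t / 2`. The identity `(I - A) C = h A` turns its proposal into the
generic one. The auxiliary variable is then integrated out by completing the square
(`gaussDensity_mul_prod_eq`): the precision in `u` is `h⁻¹ (I + N A)`, and the linear term is the
sum over all particles of `z^m - v^m` plus `v^n + φ^n`. In the resulting exponent (`exponent_eq`)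
the terms free of the index `n` form the positive factor `weightRatio`, and the others are
`logWeightFactor`. Normalised weights therefore agree, and so do the two laws. -/

lemma gaussDensity_pos {C : Matrix (Fin D) (Fin D) ℝ} (hC : C.PosDef) (m x : State D) :
    0 < gaussDensity m C x := by
  have := hC.det_pos
  unfold gaussDensity
  positivity

lemma gaussDensity_le {C : Matrix (Fin D) (Fin D) ℝ} (hC : C.PosDef) (m x : State D) :
    gaussDensity m C x ≤ (Real.sqrt ((2 * Real.pi) ^ D * C.det))⁻¹ := by
  have h := hC.inv.posSemidef.dotProduct_mulVec_nonneg (x - m)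
  simp only [star_trivial] at h
  unfold gaussDensity
  refine mul_le_of_le_one_right (by positivity) (Real.exp_le_one_iff.2 ?_)
  linarith

lemma continuous_gaussDensity (C : Matrix (Fin D) (Fin D) ℝ) :
    Continuous fun p : State D × State D => gaussDensity p.1 C p.2 := by
  unfold gaussDensity
  fun_prop

@[fun_prop]
lemma measurable_gaussDensity_comp {α : Type*} [MeasurableSpace α]
    (C : Matrix (Fin D) (Fin D) ℝ) {f g : α → State D} (hf : Measurable f) (hg : Measurable g) :
    Measurable fun a => gaussDensity (f a) C (g a) := by
  have h : Measurable fun p : State D × State D => gaussDensity p.1 C p.2 :=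
    (continuous_gaussDensity C).measurable
  have h' := h.fun_comp (hf.prodMk hg)
  exact h'

@[fun_prop]
lemma measurable_mulVec {α : Type*} [MeasurableSpace α] (M : Matrix (Fin D) (Fin D) ℝ)
    {f : α → State D} (hf : Measurable f) : Measurable fun a => M *ᵥ f a := by
  have h : Continuous fun x : State D => M *ᵥ x := by fun_prop
  exact h.measurable.comp hf

lemma exp_neg_half_dotProduct_self (y : State D) :
    Real.exp (-(1 / 2) * (y ⬝ᵥ y)) = ∏ i, Real.exp (-(1 / 2) * y i ^ 2) := by
  rw [← Real.exp_sum, dotProduct, Finset.mul_sum]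
  simp only [sq]

lemma lintegral_exp_neg_half_dotProduct_self :
    ∫⁻ y : State D, ENNReal.ofReal (Real.exp (-(1 / 2) * (y ⬝ᵥ y))) =
      ENNReal.ofReal (Real.sqrt ((2 * Real.pi) ^ D)) := by
  simp only [exp_neg_half_dotProduct_self]
  have hi : Integrable (fun y : State D => ∏ i, Real.exp (-(1 / 2) * y i ^ 2)) :=
    Integrable.fintype_prod fun _ => integrable_exp_neg_mul_sq (by norm_num)
  rw [← ofReal_integral_eq_lintegral_ofReal hi (ae_of_all _ fun y => by positivity),
    integral_fintype_prod_volume_eq_pow (fun s : ℝ => Real.exp (-(1 / 2) * s ^ 2)),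
    integral_gaussian, Fintype.card_fin]
  congr 1
  symm
  rw [Real.sqrt_eq_iff_mul_self_eq (by positivity) (by positivity), ← mul_pow,
    Real.mul_self_sqrt (by positivity)]
  congr 1
  ring

/-- In the C*-algebra of matrices with the operator norm, a nonnegative element has the form `b *
star b`. -/
lemma exists_mul_transpose_eq {C : Matrix (Fin D) (Fin D) ℝ} (hC : C.PosDef) :
    ∃ B : Matrix (Fin D) (Fin D) ℝ, B * Bᵀ = C := by
  open scoped MatrixOrder Matrix.Norms.L2Operator in
  have h := hC.posSemidef
  rw [← nonneg_iff_posSemidef, CStarAlgebra.nonneg_iff_eq_mul_star_self] at h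
  obtain ⟨B, rfl⟩ := h
  exact ⟨B, by rw [star_eq_conjTranspose, conjTranspose_eq_transpose_of_trivial]⟩

/-- After translation by `m`, the substitution `x = B y` with `C = B Bᵀ` reduces the exponent to the
standard one, and the Jacobian cancels the determinant in the constant. -/
lemma lintegral_gaussDensity {C : Matrix (Fin D) (Fin D) ℝ} (hC : C.PosDef) (m : State D) :
    ∫⁻ x, ENNReal.ofReal (gaussDensity m C x) = 1 := by
  obtain ⟨B, rfl⟩ := exists_mul_transpose_eq hC
  have hdet := hC.det_pos
  rw [det_mul, det_transpose] at hdet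
  have hB : B.det ≠ 0 := by rintro h; simp [h] at hdet
  have hBu : IsUnit B.det := isUnit_iff_ne_zero.2 hB
  set K : ℝ := (Real.sqrt ((2 * Real.pi) ^ D * (B * Bᵀ).det))⁻¹ with hK
  set f : State D → ENNReal := fun x =>
    ENNReal.ofReal (K * Real.exp (-(1 / 2) * (x ⬝ᵥ ((B * Bᵀ)⁻¹ *ᵥ x)))) with hf
  have hfm : Measurable f := by
    have : Continuous fun x : State D =>
      K * Real.exp (-(1 / 2) * (x ⬝ᵥ ((B * Bᵀ)⁻¹ *ᵥ x))) := by fun_prop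
    exact this.measurable.ennreal_ofReal
  have h1 : ∫⁻ x, ENNReal.ofReal (gaussDensity m (B * Bᵀ) x) = ∫⁻ x, f x := by
    rw [← lintegral_sub_right_eq_self f m]
    rfl
  have h2 := Real.map_matrix_volume_pi_eq_smul_volume_pi hB
  have h3 : ∫⁻ y, f (B *ᵥ y) = ENNReal.ofReal |B.det⁻¹| * ∫⁻ x, f x := by
    rw [← smul_eq_mul, ← lintegral_smul_measure, ← h2, lintegral_map hfm]
    · rfl
    · exact measurable_mulVec B measurable_id
  have h4 : ∀ y, f (B *ᵥ y) =
      ENNReal.ofReal K * ENNReal.ofReal (Real.exp (-(1 / 2) * (y ⬝ᵥ y))) := by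
    intro y
    rw [← ENNReal.ofReal_mul (by positivity), hf]
    dsimp only
    rw [Matrix.mul_inv_rev, ← mulVec_mulVec, mulVec_mulVec _ B⁻¹ B, nonsing_inv_mul _ hBu,
      one_mulVec, dotProduct_mulVec, ← mulVec_transpose, mulVec_mulVec, transpose_nonsing_inv,
      transpose_transpose, nonsing_inv_mul _ hBu, one_mulVec]
  have h5 : ENNReal.ofReal |B.det⁻¹| * ∫⁻ x, f x =
      ENNReal.ofReal K * ENNReal.ofReal (Real.sqrt ((2 * Real.pi) ^ D)) := by
    rw [← h3, ← lintegral_exp_neg_half_dotProduct_self, ← lintegral_const_mul']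
    · exact lintegral_congr h4
    · exact ENNReal.ofReal_ne_top
  -- The square root of `det (B Bᵀ)` is `|det B|`.
  have h6 : K * Real.sqrt ((2 * Real.pi) ^ D) = |B.det⁻¹| := by
    have : 0 < Real.sqrt ((2 * Real.pi) ^ D) := by positivity
    rw [hK, det_mul, det_transpose, Real.sqrt_mul (by positivity), Real.sqrt_mul_self_eq_abs,
      abs_inv]
    field_simp
  rw [← ENNReal.ofReal_mul (by positivity), h6] at h5
  rw [h1]
  have hne : ENNReal.ofReal |B.det⁻¹| ≠ 0 := by
    simpa using hB
  exact (ENNReal.mul_right_inj hne ENNReal.ofReal_ne_top).1 (by rw [h5, mul_one])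

lemma integrable_gaussDensity {C : Matrix (Fin D) (Fin D) ℝ} (hC : C.PosDef) (m : State D) :
    Integrable (gaussDensity m C) := by
  refine ⟨(measurable_gaussDensity_comp C measurable_const measurable_id).aestronglyMeasurable, ?_⟩
  rw [hasFiniteIntegral_iff_ofReal (ae_of_all _ fun x => (gaussDensity_pos hC m x).le),
    lintegral_gaussDensity hC]
  exact ENNReal.one_lt_top

lemma integral_gaussDensity {C : Matrix (Fin D) (Fin D) ℝ} (hC : C.PosDef) (m : State D) :
    ∫ x, gaussDensity m C x = 1 := by
  rw [integral_eq_lintegral_of_nonneg_ae (ae_of_all _ fun x => (gaussDensity_pos hC m x).le)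
    (integrable_gaussDensity hC m).1, lintegral_gaussDensity hC, ENNReal.toReal_one]

end GaussianDensity

end ParticleMGRAD

namespace ParticleMGRAD

/-! ### Sums over finite sequences of indices. -/

section FiniteSums

lemma sum_fin_snoc {S : ℕ} {I R : Type*} [Fintype I] [AddCommMonoid R]
    (f : (Fin (S + 1) → I) → R) :
    ∑ a, f a = ∑ a' : Fin S → I, ∑ i : I, f (Fin.snoc a' i) := by
  rw [← (Fin.snocEquiv fun _ => I).sum_comp, Fintype.sum_prod_type_right]
  rfl

/-- Each `K s` is a backward transition, normalised in its earlier index, so the indices sum out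
from the first time onwards until only the last remains. It serves twice: for backward sampling, and
for tracing ancestors, where `K s i j` is the indicator of `a s j = i`. -/
lemma sum_mul_prod_chain {S : ℕ} {I R : Type*} [Fintype I] [CommSemiring R] (f : I → R)
    (K : Fin S → I → I → R) (hK : ∀ s j, ∑ i, K s i j = 1) :
    ∑ l : Fin (S + 1) → I, f (l (Fin.last S)) * ∏ s : Fin S, K s (l s.castSucc) (l s.succ) =
      ∑ i, f i := by
  induction S with
  | zero =>
    rw [← (Equiv.funUnique (Fin 1) I).symm.sum_comp]
    simp
  | succ S ih =>
    rw [← (Fin.consEquiv fun _ => I).sum_comp, Fintype.sum_prod_type_right,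
      ← ih (fun s => K s.succ) fun s => hK s.succ]
    refine Finset.sum_congr rfl fun l _ => ?_
    have h : ∀ i, f ((Fin.consEquiv fun _ => I) (i, l) (Fin.last (S + 1))) *
        ∏ s : Fin (S + 1), K s ((Fin.consEquiv fun _ => I) (i, l) s.castSucc)
          ((Fin.consEquiv fun _ => I) (i, l) s.succ) =
        K 0 i (l 0) * (f (l (Fin.last S)) *
          ∏ s : Fin S, K s.succ (l s.castSucc) (l s.succ)) := by
      intro i
      rw [Fin.prod_univ_succ, ← Fin.succ_last]
      simp only [Fin.consEquiv_apply, Fin.castSucc_zero, Fin.cons_zero, Fin.cons_succ,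
        ← Fin.succ_castSucc]
      ring
    rw [Finset.sum_congr rfl fun i _ => h i, ← Finset.sum_mul, hK, one_mul]

/-- The summand is a product over coordinates, with `f` in place of `W` at `k`; every other
coordinate contributes total mass one. -/
lemma sum_pi_prod_mul {N : ℕ} {I R : Type*} [Fintype I] [CommSemiring R] {W : I → R}
    (hW : ∑ i, W i = 1) (f : I → R) (k : Fin (N + 1)) :
    ∑ α : Fin (N + 1) → I, f (α k) * ∏ n ∈ Finset.univ.erase k, W (α n) = ∑ i, f i := by
  classical
  have h : ∀ α : Fin (N + 1) → I, f (α k) * ∏ n ∈ Finset.univ.erase k, W (α n) =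
      ∏ n, (if n = k then f else W) (α n) := by
    intro α
    rw [← Finset.mul_prod_erase _ _ (Finset.mem_univ k), if_pos rfl]
    congr 1
    exact Finset.prod_congr rfl fun n hn => by rw [if_neg (Finset.ne_of_mem_erase hn)]
  rw [Finset.sum_congr rfl fun α _ => h α, ← Fintype.piFinset_univ,
    Finset.sum_prod_piFinset, ← Finset.mul_prod_erase _ _ (Finset.mem_univ k), if_pos rfl]
  rw [Finset.prod_congr rfl fun n hn => by rw [if_neg (Finset.ne_of_mem_erase hn), hW],
    Finset.prod_const_one, mul_one]

end FiniteSums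

/-! ### The forced move and its reversibility. -/

section ForcedMove

variable {N : ℕ} {W : Fin (N + 1) → ℝ}

lemma sum_normalise {w : Fin (N + 1) → ℝ} (hw : ∀ n, 0 < w n) : ∑ n, normalise w n = 1 := by
  have h : 0 < ∑ n, w n := Finset.sum_pos (fun n _ => hw n) Finset.univ_nonempty
  simp only [normalise]
  rw [← Finset.sum_div, div_self h.ne']

lemma normalise_pos {w : Fin (N + 1) → ℝ} (hw : ∀ n, 0 < w n) (n : Fin (N + 1)) :
    0 < normalise w n :=
  div_pos (hw n) (Finset.sum_pos (fun n _ => hw n) Finset.univ_nonempty)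

lemma sum_erase_eq_one_sub (hsum : ∑ n, W n = 1) (k : Fin (N + 1)) :
    ∑ i ∈ Finset.univ.erase k, W i = 1 - W k := by
  rw [← hsum, ← Finset.add_sum_erase _ _ (Finset.mem_univ k)]
  ring

/-- Since `1 ≤ N`, some other particle carries positive weight. This makes the denominators `1 - W
k` of the forced move positive. -/
lemma lt_one_of_sum_eq_one (hN : 1 ≤ N) (hW : ∀ n, 0 < W n) (hsum : ∑ n, W n = 1)
    (k : Fin (N + 1)) : W k < 1 := by
  have h : 0 < ∑ i ∈ Finset.univ.erase k, W i := by
    refine Finset.sum_pos (fun n _ => hW n) (Finset.card_pos.1 ?_)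
    rw [Finset.card_erase_of_mem (Finset.mem_univ k), Finset.card_univ, Fintype.card_fin]
    omega
  rw [sum_erase_eq_one_sub hsum] at h
  linarith

lemma forcedMove_nonneg (hN : 1 ≤ N) (hW : ∀ n, 0 < W n) (hsum : ∑ n, W n = 1)
    (k l : Fin (N + 1)) : 0 ≤ forcedMove W k l := by
  refine Finset.sum_nonneg fun i _ => ?_
  have hk := lt_one_of_sum_eq_one hN hW hsum k
  have hi := lt_one_of_sum_eq_one hN hW hsum i
  have h1 : 0 ≤ (1 - W k) / (1 - W i) := div_nonneg (by linarith) (by linarith)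
  have h2 : 0 ≤ min 1 ((1 - W k) / (1 - W i)) := le_min zero_le_one h1
  have h3 : 0 ≤ 1 - min 1 ((1 - W k) / (1 - W i)) := sub_nonneg.2 (min_le_left _ _)
  refine mul_nonneg (div_nonneg (hW i).le (by linarith)) (add_nonneg ?_ ?_) <;> split_ifs <;>
    first | assumption | exact le_rfl

lemma sum_forcedMove (hN : 1 ≤ N) (hW : ∀ n, 0 < W n) (hsum : ∑ n, W n = 1)
    (k : Fin (N + 1)) : ∑ l, forcedMove W k l = 1 := by
  have hk := lt_one_of_sum_eq_one hN hW hsum k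
  unfold forcedMove
  rw [Finset.sum_comm]
  simp only [← Finset.mul_sum, Finset.sum_add_distrib, Finset.sum_ite_eq', Finset.mem_univ,
    if_true, add_sub_cancel, mul_one]
  rw [← Finset.sum_div, sum_erase_eq_one_sub hsum, div_self (by linarith)]

lemma forcedMove_of_ne {k l : Fin (N + 1)} (h : l ≠ k) :
    forcedMove W k l = W l / (1 - W k) * min 1 ((1 - W k) / (1 - W l)) := by
  unfold forcedMove
  rw [Finset.sum_eq_single l]
  · simp [h]
  · intro i _ hi
    simp [h, hi.symm]
  · intro hl
    exact absurd (Finset.mem_erase.2 ⟨h, Finset.mem_univ l⟩) hl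

/-- For `l ≠ k` both sides equal `W k * W l * min (1 / (1 - W k)) (1 / (1 - W l))`, which is
symmetric in `k` and `l`. -/
lemma forcedMove_detailed_balance (hN : 1 ≤ N) (hW : ∀ n, 0 < W n) (hsum : ∑ n, W n = 1)
    (k l : Fin (N + 1)) : W k * forcedMove W k l = W l * forcedMove W l k := by
  rcases eq_or_ne l k with rfl | h
  · rfl
  have hk : 0 < 1 - W k := sub_pos.2 (lt_one_of_sum_eq_one hN hW hsum k)
  have hl : 0 < 1 - W l := sub_pos.2 (lt_one_of_sum_eq_one hN hW hsum l)
  rw [forcedMove_of_ne h, forcedMove_of_ne h.symm]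
  have h1 : ∀ a b : ℝ, 0 < a → 0 < b → min 1 (a / b) / a = min (1 / a) (1 / b) := by
    intro a b ha hb
    rw [← min_div_div_right ha.le]
    congr 1
    field_simp
  calc W k * (W l / (1 - W k) * min 1 ((1 - W k) / (1 - W l)))
      = W k * W l * (min 1 ((1 - W k) / (1 - W l)) / (1 - W k)) := by ring
    _ = W k * W l * (min 1 ((1 - W l) / (1 - W k)) / (1 - W l)) := by
      rw [h1 _ _ hk hl, h1 _ _ hl hk, min_comm]
    _ = W l * (W k / (1 - W l) * min 1 ((1 - W l) / (1 - W k))) := by ring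

lemma sum_mul_forcedMove (hN : 1 ≤ N) (hW : ∀ n, 0 < W n) (hsum : ∑ n, W n = 1)
    (l : Fin (N + 1)) : ∑ k, forcedMove W k l * W k = W l := by
  simp only [mul_comm _ (W _), forcedMove_detailed_balance hN hW hsum _ l]
  rw [← Finset.mul_sum, sum_forcedMove hN hW hsum, mul_one]

end ForcedMove

/-! ### Ancestors and preceding states when one time step is appended. -/

section Splitting

variable {S N D : ℕ}

lemma ancestors_zero (a : Fin S → Fin (N + 1) → Fin (N + 1)) (z : Fin (S + 1) → Particles N D) :
    ancestors a z 0 = fun _ => 0 := rfl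

lemma ancestors_succ (a : Fin S → Fin (N + 1) → Fin (N + 1)) (z : Fin (S + 1) → Particles N D)
    (s : Fin S) : ancestors a z s.succ = fun n => z s.castSucc (a s n) := rfl

lemma prevState_zero (x : Path S D) : prevState x 0 = 0 := rfl

lemma prevState_succ (x : Path S D) (s : Fin S) : prevState x s.succ = x s.castSucc := rfl

lemma ancestors_snoc_castSucc (a : Fin S → Fin (N + 1) → Fin (N + 1))
    (α : Fin (N + 1) → Fin (N + 1)) (z : Fin (S + 1) → Particles N D) (ζ : Particles N D)
    (t : Fin (S + 1)) :
    ancestors (Fin.snoc a α : Fin (S + 1) → Fin (N + 1) → Fin (N + 1))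
      (Fin.snoc z ζ : Fin (S + 2) → Particles N D) t.castSucc = ancestors a z t := by
  cases t using Fin.cases with
  | zero => rfl
  | succ s =>
    rw [← Fin.succ_castSucc, ancestors_succ, ancestors_succ, Fin.snoc_castSucc, Fin.snoc_castSucc]

lemma ancestors_snoc_last (a : Fin S → Fin (N + 1) → Fin (N + 1))
    (α : Fin (N + 1) → Fin (N + 1)) (z : Fin (S + 1) → Particles N D) (ζ : Particles N D) :
    ancestors (Fin.snoc a α : Fin (S + 1) → Fin (N + 1) → Fin (N + 1))
      (Fin.snoc z ζ : Fin (S + 2) → Particles N D) (Fin.last (S + 1)) =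
      fun n => z (Fin.last S) (α n) := by
  rw [← Fin.succ_last, ancestors_succ, Fin.snoc_castSucc, Fin.snoc_last]

lemma prevState_snoc_castSucc (x : Path S D) (ξ : State D) (t : Fin (S + 1)) :
    prevState (Fin.snoc x ξ : Path (S + 1) D) t.castSucc = prevState x t := by
  cases t using Fin.cases with
  | zero => rfl
  | succ s => rw [← Fin.succ_castSucc, prevState_succ, prevState_succ, Fin.snoc_castSucc]

lemma prevState_snoc_last (x : Path S D) (ξ : State D) :
    prevState (Fin.snoc x ξ : Path (S + 1) D) (Fin.last (S + 1)) = x (Fin.last S) := by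
  rw [← Fin.succ_last, prevState_succ, Fin.snoc_castSucc]

lemma measurable_ancestors (a : Fin S → Fin (N + 1) → Fin (N + 1)) (t : Fin (S + 1)) :
    Measurable fun z : Fin (S + 1) → Particles N D => ancestors a z t := by
  cases t using Fin.cases with
  | zero => exact measurable_const
  | succ s =>
    simp only [ancestors_succ]
    fun_prop

lemma measurable_prevState (t : Fin (S + 1)) :
    Measurable fun x : Path S D => prevState x t := by
  cases t using Fin.cases with
  | zero => exact measurable_const
  | succ s =>
    simp only [prevState_succ]
    fun_prop

end Splitting

/-! ### Lebesgue integrals with one coordinate singled out. -/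

section ProductMeasures

lemma measurePreserving_insertNth {N : ℕ} {E : Type*} [MeasureSpace E]
    [SigmaFinite (volume : Measure E)] (k : Fin (N + 1)) :
    MeasurePreserving (fun p : E × (Fin N → E) => (k.insertNth p.1 p.2 : Fin (N + 1) → E)) :=
  (volume_preserving_piFinSuccAbove (fun _ : Fin (N + 1) => E) k).symm

lemma lintegral_insertNth {N : ℕ} {E : Type*} [MeasureSpace E]
    [SigmaFinite (volume : Measure E)] (k : Fin (N + 1)) {f : (Fin (N + 1) → E) → ENNReal}
    (hf : Measurable f) :
    ∫⁻ z, f z = ∫⁻ x, ∫⁻ r : Fin N → E, f (k.insertNth x r) := by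
  have h := measurePreserving_insertNth (E := E) k
  rw [← h.lintegral_comp hf]
  exact lintegral_prod _ (hf.comp h.measurable).aemeasurable

lemma lintegral_snoc {S : ℕ} {E : Type*} [MeasureSpace E]
    [SigmaFinite (volume : Measure E)] {f : (Fin (S + 1) → E) → ENNReal}
    (hf : Measurable f) :
    ∫⁻ z, f z = ∫⁻ z' : Fin S → E, ∫⁻ x, f (Fin.snoc z' x) := by
  have h := measurePreserving_insertNth (E := E) (Fin.last S)
  rw [← h.lintegral_comp hf]
  refine (lintegral_prod_symm _ (hf.comp h.measurable).aemeasurable).trans ?_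
  simp only [Fin.insertNth_last', Function.comp_apply]

lemma measurable_snoc {S : ℕ} {E : Type*} [MeasurableSpace E] :
    Measurable fun p : (Fin S → E) × E => (Fin.snoc p.1 p.2 : Fin (S + 1) → E) := by
  rw [measurable_pi_iff]
  intro i
  cases i using Fin.lastCases with
  | last => simp only [Fin.snoc_last]; fun_prop
  | cast i => simp only [Fin.snoc_castSucc]; fun_prop

end ProductMeasures

end ParticleMGRAD

namespace ParticleMGRAD

/-! ### Marginal schemes: factors of the joint density, and the law as a Lebesgue integral. -/

section CSMCInvariance

variable {S N D : ℕ}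

/-- Positive measurable functions `Q t`, together with proposal densities `prop t k y`
which integrate to one over the particles with index different from `k`. -/
structure IsMarginalScheme (Q : Fin (S + 1) → State D → State D → ℝ)
    (prop : Fin (S + 1) → Fin (N + 1) → Particles N D → Particles N D → ℝ) : Prop where
  Q_pos : ∀ t y x, 0 < Q t y x
  measurable_Q : ∀ t, Measurable fun p : State D × State D => Q t p.1 p.2
  prop_pos : ∀ t k y z, 0 < prop t k y z
  measurable_prop : ∀ t k, Measurable fun p : Particles N D × Particles N D => prop t k p.1 p.2
  lintegral_prop : ∀ t k y x,
    ∫⁻ r : Fin N → State D, ENNReal.ofReal (prop t k y (k.insertNth x r)) = 1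

/-- The weights `Q_t(y^n, z^n) q_t^{-n}(z^{-n} | z^n)` of a general proposal. -/
def marginalWeight (Q : Fin (S + 1) → State D → State D → ℝ)
    (prop : Fin (S + 1) → Fin (N + 1) → Particles N D → Particles N D → ℝ)
    (t : Fin (S + 1)) (y z : Particles N D) (n : Fin (N + 1)) : ℝ :=
  Q t (y n) (z n) * prop t n y z

/-- The normalised weights of a run of the algorithm. -/
noncomputable def runWeights
    (w : Fin (S + 1) → Particles N D → Particles N D → Fin (N + 1) → ℝ)
    (a : Fin S → Fin (N + 1) → Fin (N + 1)) (z : Fin (S + 1) → Particles N D)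
    (t : Fin (S + 1)) : Fin (N + 1) → ℝ :=
  normalise (w t (ancestors a z t) (z t))

/-- The joint density of the reference indices, the particles and the ancestor indices. -/
noncomputable def forwardDensity
    (prop : Fin (S + 1) → Fin (N + 1) → Particles N D → Particles N D → ℝ)
    (w : Fin (S + 1) → Particles N D → Particles N D → Fin (N + 1) → ℝ)
    (k : Fin (S + 1) → Fin (N + 1)) (a : Fin S → Fin (N + 1) → Fin (N + 1))
    (z : Fin (S + 1) → Particles N D) : ℝ :=
  (∏ t, 1 / ((N : ℝ) + 1) * prop t (k t) (ancestors a z t) (z t)) *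
  (∏ s : Fin S, (if a s (k s.succ) = k s.castSucc then 1 else 0) *
    ∏ n ∈ Finset.univ.erase (k s.succ), runWeights w a z s.castSucc (a s n))

/-- The probability of drawing index `i` in backward sampling when the weights are `W` and the
next state is `x`. -/
noncomputable def backwardProb (Q : State D → State D → ℝ) (W : Fin (N + 1) → ℝ)
    (z : Particles N D) (x : State D) (i : Fin (N + 1)) : ℝ :=
  (W i * Q (z i) x) / ∑ n, W n * Q (z n) x

lemma jointDensity_eq (Q : Fin (S + 1) → State D → State D → ℝ)
    (prop : Fin (S + 1) → Fin (N + 1) → Particles N D → Particles N D → ℝ)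
    (w : Fin (S + 1) → Particles N D → Particles N D → Fin (N + 1) → ℝ)
    (k : Fin (S + 1) → Fin (N + 1)) (a : Fin S → Fin (N + 1) → Fin (N + 1))
    (l : Fin (S + 1) → Fin (N + 1)) (z : Fin (S + 1) → Particles N D) :
    jointDensity Q prop w k a l z = forwardDensity prop w k a z *
      (forcedMove (runWeights w a z (Fin.last S)) (k (Fin.last S)) (l (Fin.last S)) *
      ∏ s : Fin S, backwardProb (Q s.succ) (runWeights w a z s.castSucc) (z s.castSucc)
        (z s.succ (l s.succ)) (l s.castSucc)) := by
  rw [← mul_assoc]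
  rfl

lemma sum_backwardProb {Q : State D → State D → ℝ} (hQ : ∀ y x, 0 < Q y x)
    {W : Fin (N + 1) → ℝ} (hW : ∀ n, 0 < W n) (z : Particles N D) (x : State D) :
    ∑ i, backwardProb Q W z x i = 1 := by
  have h : 0 < ∑ n, W n * Q (z n) x :=
    Finset.sum_pos (fun n _ => mul_pos (hW n) (hQ _ _)) Finset.univ_nonempty
  simp only [backwardProb]
  rw [← Finset.sum_div, div_self h.ne']

lemma backwardProb_pos {Q : State D → State D → ℝ} (hQ : ∀ y x, 0 < Q y x)
    {W : Fin (N + 1) → ℝ} (hW : ∀ n, 0 < W n) (z : Particles N D) (x : State D)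
    (i : Fin (N + 1)) : 0 < backwardProb Q W z x i :=
  div_pos (mul_pos (hW i) (hQ _ _))
    (Finset.sum_pos (fun n _ => mul_pos (hW n) (hQ _ _)) Finset.univ_nonempty)

/-- The joint density of particles, ancestor indices and output indices after summing out the
reference indices, when the reference path has the target law, except for the probability of the
last output index. -/
noncomputable def smoothingCore (Q : Fin (S + 1) → State D → State D → ℝ)
    (w : Fin (S + 1) → Particles N D → Particles N D → Fin (N + 1) → ℝ)
    (a : Fin S → Fin (N + 1) → Fin (N + 1)) (l : Fin (S + 1) → Fin (N + 1))
    (z : Fin (S + 1) → Particles N D) : ℝ :=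
  (∏ t, (∑ m, w t (ancestors a z t) (z t) m) / ((N : ℝ) + 1)) *
  (∏ s : Fin S, ∏ n, runWeights w a z s.castSucc (a s n)) *
  ∏ s : Fin S, backwardProb (Q s.succ) (runWeights w a z s.castSucc) (z s.castSucc)
    (z s.succ (l s.succ)) (l s.castSucc)

/-- The joint density of particles, ancestor indices and output indices after summing out the
reference indices, when the reference path has the target law. -/
noncomputable def smoothingDensity (Q : Fin (S + 1) → State D → State D → ℝ)
    (w : Fin (S + 1) → Particles N D → Particles N D → Fin (N + 1) → ℝ)
    (a : Fin S → Fin (N + 1) → Fin (N + 1)) (l : Fin (S + 1) → Fin (N + 1))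
    (z : Fin (S + 1) → Particles N D) : ℝ :=
  smoothingCore Q w a l z * runWeights w a z (Fin.last S) (l (Fin.last S))

section Measurability

variable {Q : Fin (S + 1) → State D → State D → ℝ}
  {prop : Fin (S + 1) → Fin (N + 1) → Particles N D → Particles N D → ℝ}
  {w : Fin (S + 1) → Particles N D → Particles N D → Fin (N + 1) → ℝ}

lemma measurable_weight_comp_ancestors
    (hw : ∀ t n, Measurable fun p : Particles N D × Particles N D => w t p.1 p.2 n)
    (a : Fin S → Fin (N + 1) → Fin (N + 1)) (t : Fin (S + 1)) (n : Fin (N + 1)) :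
    Measurable fun z : Fin (S + 1) → Particles N D => w t (ancestors a z t) (z t) n :=
  (hw t n).fun_comp ((measurable_ancestors a t).prodMk (measurable_pi_apply t))

lemma measurable_runWeights
    (hw : ∀ t n, Measurable fun p : Particles N D × Particles N D => w t p.1 p.2 n)
    (a : Fin S → Fin (N + 1) → Fin (N + 1)) (t : Fin (S + 1)) (n : Fin (N + 1)) :
    Measurable fun z : Fin (S + 1) → Particles N D => runWeights w a z t n := by
  unfold runWeights normalise
  exact (measurable_weight_comp_ancestors hw a t n).div
    (Finset.measurable_fun_sum _ fun m _ => measurable_weight_comp_ancestors hw a t m)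

lemma measurable_forwardDensity
    (hprop : ∀ t k, Measurable fun p : Particles N D × Particles N D => prop t k p.1 p.2)
    (hw : ∀ t n, Measurable fun p : Particles N D × Particles N D => w t p.1 p.2 n)
    (k : Fin (S + 1) → Fin (N + 1)) (a : Fin S → Fin (N + 1) → Fin (N + 1)) :
    Measurable fun z => forwardDensity prop w k a z := by
  unfold forwardDensity
  refine (Finset.measurable_fun_prod _ fun t _ => measurable_const.mul ?_).mul
    (Finset.measurable_fun_prod _ fun s _ => measurable_const.mul
      (Finset.measurable_fun_prod _ fun n _ => measurable_runWeights hw a _ _))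
  exact (hprop t (k t)).fun_comp ((measurable_ancestors a t).prodMk (measurable_pi_apply t))

lemma measurable_backward
    (hQ : ∀ t, Measurable fun p : State D × State D => Q t p.1 p.2)
    (hw : ∀ t n, Measurable fun p : Particles N D × Particles N D => w t p.1 p.2 n)
    (a : Fin S → Fin (N + 1) → Fin (N + 1)) (l : Fin (S + 1) → Fin (N + 1)) :
    Measurable fun z : Fin (S + 1) → Particles N D =>
      ∏ s : Fin S, backwardProb (Q s.succ) (runWeights w a z s.castSucc) (z s.castSucc)
        (z s.succ (l s.succ)) (l s.castSucc) := by
  refine Finset.measurable_fun_prod _ fun s _ => ?_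
  unfold backwardProb
  have h : ∀ n, Measurable fun z : Fin (S + 1) → Particles N D =>
      runWeights w a z s.castSucc n * Q s.succ (z s.castSucc n) (z s.succ (l s.succ)) := by
    intro n
    refine (measurable_runWeights hw a _ _).mul ((hQ s.succ).fun_comp (Measurable.prodMk ?_ ?_))
    · fun_prop
    · fun_prop
  exact (h _).div (Finset.measurable_fun_sum _ fun n _ => h n)

lemma measurable_forcedMove {α : Type*} [MeasurableSpace α] {W : α → Fin (N + 1) → ℝ}
    (hW : ∀ n, Measurable fun x => W x n) (k l : Fin (N + 1)) :
    Measurable fun x => forcedMove (W x) k l := by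
  unfold forcedMove
  have h : ∀ i, Measurable fun x => min 1 ((1 - W x k) / (1 - W x i)) := fun i =>
    measurable_const.min ((measurable_const.sub (hW k)).div (measurable_const.sub (hW i)))
  refine Finset.measurable_fun_sum _ fun i _ =>
    ((hW i).div (measurable_const.sub (hW k))).mul (Measurable.add ?_ ?_)
  · split_ifs
    · exact h i
    · exact measurable_const
  · split_ifs
    · exact measurable_const.sub (h i)
    · exact measurable_const

lemma measurable_jointDensity
    (hQ : ∀ t, Measurable fun p : State D × State D => Q t p.1 p.2)
    (hprop : ∀ t k, Measurable fun p : Particles N D × Particles N D => prop t k p.1 p.2)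
    (hw : ∀ t n, Measurable fun p : Particles N D × Particles N D => w t p.1 p.2 n)
    (k : Fin (S + 1) → Fin (N + 1)) (a : Fin S → Fin (N + 1) → Fin (N + 1))
    (l : Fin (S + 1) → Fin (N + 1)) :
    Measurable fun z => jointDensity Q prop w k a l z := by
  simp only [jointDensity_eq]
  exact (measurable_forwardDensity hprop hw k a).mul
    ((measurable_forcedMove (fun n => measurable_runWeights hw a _ n) _ _).mul
      (measurable_backward hQ hw a l))

lemma measurable_smoothingDensity
    (hQ : ∀ t, Measurable fun p : State D × State D => Q t p.1 p.2)
    (hw : ∀ t n, Measurable fun p : Particles N D × Particles N D => w t p.1 p.2 n)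
    (a : Fin S → Fin (N + 1) → Fin (N + 1)) (l : Fin (S + 1) → Fin (N + 1)) :
    Measurable fun z => smoothingDensity Q w a l z := by
  unfold smoothingDensity smoothingCore
  exact (((Finset.measurable_fun_prod _ fun t _ => (Finset.measurable_fun_sum _ fun m _ =>
    measurable_weight_comp_ancestors hw a t m).div_const _).mul
    (Finset.measurable_fun_prod _ fun s _ => Finset.measurable_fun_prod _ fun n _ =>
      measurable_runWeights hw a _ _)).mul (measurable_backward hQ hw a l)).mul
    (measurable_runWeights hw a _ _)

end Measurability

/-! ### The law of the algorithm as an integral over Lebesgue measure -/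

/-- The array of particles with reference path `x` at the indices `k` and the other particles
given by `r`. -/
def insertPath (k : Fin (S + 1) → Fin (N + 1)) (x : Path S D)
    (r : Fin (S + 1) → Fin N → State D) : Fin (S + 1) → Particles N D :=
  fun t => (k t).insertNth (x t) (r t)

lemma measurable_insertPath (k : Fin (S + 1) → Fin (N + 1)) :
    Measurable fun p : Path S D × (Fin (S + 1) → Fin N → State D) => insertPath k p.1 p.2 := by
  refine measurable_pi_iff.2 fun t => ?_
  have h := (measurePreserving_insertNth (E := State D) (k t)).measurable
  have h2 : Measurable fun p : Path S D × (Fin (S + 1) → Fin N → State D) => (p.1 t, p.2 t) := by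
    fun_prop
  exact h.fun_comp h2

lemma insertPath_snoc (k : Fin (S + 1) → Fin (N + 1)) (κ : Fin (N + 1)) (x : Path S D)
    (ξ : State D) (r : Fin (S + 1) → Fin N → State D) (ρ : Fin N → State D) :
    insertPath (Fin.snoc k κ : Fin (S + 2) → Fin (N + 1)) (Fin.snoc x ξ : Path (S + 1) D)
      (Fin.snoc r ρ : Fin (S + 2) → Fin N → State D) =
      (Fin.snoc (insertPath k x r) (κ.insertNth ξ ρ : Particles N D) :
        Fin (S + 2) → Particles N D) := by
  funext t
  cases t using Fin.lastCases with
  | last => simp only [insertPath, Fin.snoc_last]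
  | cast t => simp only [insertPath, Fin.snoc_castSucc]

/-- Singling out coordinate `k` makes the product measure the product of a Dirac mass at `x` and
Lebesgue measure, which is Lebesgue measure carried to the slice over `x`. -/
lemma pi_dirac_eq_map (k : Fin (N + 1)) (x : State D) :
    (Measure.pi fun n : Fin (N + 1) =>
      if n = k then Measure.dirac x else (volume : Measure (State D))) =
    (volume : Measure (Fin N → State D)).map fun r => (k.insertNth x r : Particles N D) := by
  have : ∀ n, SigmaFinite (if n = k then Measure.dirac x else (volume : Measure (State D))) := by
    intro n
    split_ifs <;> infer_instance
  have h := (measurePreserving_piFinSuccAbove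
    (fun n : Fin (N + 1) => if n = k then Measure.dirac x else (volume : Measure (State D)))
    k).symm.map_eq
  rw [← h]
  simp only [if_true, Fin.succAbove_ne, if_false]
  rw [Measure.dirac_prod, Measure.map_map (MeasurableEquiv.measurable _) (by fun_prop)]
  rfl

lemma particleMeasure_eq_map (x : Path S D) (k : Fin (S + 1) → Fin (N + 1)) :
    particleMeasure x k = (volume : Measure (Fin (S + 1) → Fin N → State D)).map
      (insertPath k x) := by
  unfold particleMeasure
  simp only [pi_dirac_eq_map]
  have hm : ∀ t, Measurable fun r : Fin N → State D =>
      ((k t).insertNth (x t) r : Particles N D) := fun t =>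
    (measurePreserving_insertNth (E := State D) (k t)).measurable.fun_comp
      (measurable_const.prodMk measurable_id)
  -- A pushforward need not be σ-finite; this one is, being a product of σ-finite measures by
  -- `pi_dirac_eq_map`.
  have : ∀ t, SigmaFinite ((volume : Measure (Fin N → State D)).map
      fun r => ((k t).insertNth (x t) r : Particles N D)) := by
    intro t
    rw [← pi_dirac_eq_map]
    have : ∀ n, SigmaFinite
        (if n = k t then Measure.dirac (x t) else (volume : Measure (State D))) := by
      intro n
      split_ifs <;> infer_instance
    infer_instance
  exact (Measure.pi_map_pi fun t => (hm t).aemeasurable).symm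

/-- Integrating the reference path fills the one slot per time that the Dirac masses had fixed. The
resulting Lebesgue measure does not involve `k`, so the sum over `k` can later be taken under the
integral. -/
lemma lintegral_insertPath (k : Fin (S + 1) → Fin (N + 1))
    {f : (Fin (S + 1) → Particles N D) → ENNReal} (hf : Measurable f) :
    ∫⁻ x : Path S D, ∫⁻ r, f (insertPath k x r) = ∫⁻ z, f z := by
  have h1 := (volume_measurePreserving_arrowProdEquivProdArrow (State D) (Fin N → State D)
    (Fin (S + 1))).symm
  have h2 : MeasurePreserving
      (fun p : Fin (S + 1) → State D × (Fin N → State D) => fun t =>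
        ((k t).insertNth (p t).1 (p t).2 : Particles N D)) :=
    measurePreserving_pi _ _ fun t => measurePreserving_insertNth (E := State D) (k t)
  rw [← (h2.comp h1).lintegral_comp hf]
  exact (lintegral_prod _ (hf.comp (h2.comp h1).measurable).aemeasurable).symm

lemma insertPath_apply_self (k : Fin (S + 1) → Fin (N + 1)) (x : Path S D)
    (r : Fin (S + 1) → Fin N → State D) : (fun t => insertPath k x r t (k t)) = x := by
  funext t
  simp [insertPath]

lemma lintegral_csmcLaw {Q : Fin (S + 1) → State D → State D → ℝ}
    {prop : Fin (S + 1) → Fin (N + 1) → Particles N D → Particles N D → ℝ}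
    {w : Fin (S + 1) → Particles N D → Particles N D → Fin (N + 1) → ℝ}
    (hJ : ∀ k a l, Measurable fun z => jointDensity Q prop w k a l z)
    (x : Path S D) {g : Path S D → ENNReal} (hg : Measurable g) :
    ∫⁻ x', g x' ∂csmcLaw Q prop w x = ∑ k, ∑ a, ∑ l, ∫⁻ r,
      ENNReal.ofReal (jointDensity Q prop w k a l (insertPath k x r)) *
        g fun t => insertPath k x r t (l t) := by
  unfold csmcLaw
  simp only [lintegral_finsetSum_measure]
  refine Finset.sum_congr rfl fun k _ => Finset.sum_congr rfl fun a _ =>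
    Finset.sum_congr rfl fun l _ => ?_
  have hsel : Measurable fun (z : Fin (S + 1) → Particles N D) t => z t (l t) := by fun_prop
  have hins : Measurable (insertPath (N := N) k x) :=
    (measurable_insertPath k).fun_comp (measurable_const.prodMk measurable_id)
  rw [lintegral_map hg hsel]
  refine (lintegral_withDensity_eq_lintegral_mul _ (hJ k a l).ennreal_ofReal
    (hg.comp hsel)).trans ?_
  rw [particleMeasure_eq_map,
    lintegral_map ((hJ k a l).ennreal_ofReal.mul (hg.comp hsel)) hins]
  rfl

end CSMCInvariance

end ParticleMGRAD

namespace ParticleMGRAD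

/-! ### Integrating out a single time step. -/

section OneStep

variable {N D : ℕ}

lemma lintegral_mul_proposal {p : Particles N D → ℝ} {k : Fin (N + 1)}
    (hp : Measurable p)
    (hint : ∀ x, ∫⁻ r : Fin N → State D, ENNReal.ofReal (p (k.insertNth x r)) = 1)
    {c : State D → ENNReal} (hc : Measurable c) :
    ∫⁻ z : Particles N D, c (z k) * ENNReal.ofReal (p z) = ∫⁻ x, c x := by
  have hm : Measurable fun z : Particles N D => c (z k) * ENNReal.ofReal (p z) :=
    (hc.comp (measurable_pi_apply k)).mul hp.ennreal_ofReal
  refine (lintegral_insertNth k hm).trans (lintegral_congr fun x => ?_)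
  simp only [Fin.insertNth_apply_same]
  have hins : Measurable fun r : Fin N → State D => (k.insertNth x r : Particles N D) :=
    (measurePreserving_insertNth (E := State D) k).measurable.fun_comp
      (measurable_const.prodMk measurable_id)
  have hpm : Measurable fun r : Fin N → State D => p (k.insertNth x r) := hp.comp hins
  rw [lintegral_const_mul _ hpm.ennreal_ofReal, hint, mul_one]

lemma natCast_succ_mul_ofReal_inv (N : ℕ) :
    ((N + 1 : ℕ) : ENNReal) * ENNReal.ofReal (1 / ((N : ℝ) + 1)) = 1 := by
  rw [← ENNReal.ofReal_natCast, ← ENNReal.ofReal_mul (by positivity)]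
  push_cast
  rw [mul_one_div_cancel (by positivity), ENNReal.ofReal_one]

/-- The new particles are integrated first, because their density depends on the ancestors; then the
free ancestors sum to one, the ancestor of the reference particle is forced to be `j`, and the
uniform reference index contributes `(N + 1) · 1 / (N + 1)`. -/
lemma sum_lintegral_forward_step
    {p : Fin (N + 1) → Particles N D → Particles N D → ℝ}
    (hint : ∀ k y x, ∫⁻ r : Fin N → State D, ENNReal.ofReal (p k y (k.insertNth x r)) = 1)
    {W : Fin (N + 1) → ℝ} (hW : ∀ n, 0 < W n) (hsum : ∑ n, W n = 1) (j : Fin (N + 1))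
    (Z : Particles N D) (ξ : State D) :
    ∑ k, ∑ α : Fin (N + 1) → Fin (N + 1), ∫⁻ ρ : Fin N → State D,
      ENNReal.ofReal (1 / ((N : ℝ) + 1) * p k (fun n => Z (α n)) (k.insertNth ξ ρ) *
        ((if α k = j then 1 else 0) * ∏ n ∈ Finset.univ.erase k, W (α n))) = 1 := by
  have hnn : ∀ k (α : Fin (N + 1) → Fin (N + 1)),
      (0 : ℝ) ≤ (if α k = j then 1 else 0) * ∏ n ∈ Finset.univ.erase k, W (α n) := fun k α =>
    mul_nonneg (by split_ifs <;> norm_num) (Finset.prod_nonneg fun n _ => (hW _).le)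
  have h1 : ∀ k (α : Fin (N + 1) → Fin (N + 1)), ∫⁻ ρ : Fin N → State D,
      ENNReal.ofReal (1 / ((N : ℝ) + 1) * p k (fun n => Z (α n)) (k.insertNth ξ ρ) *
        ((if α k = j then 1 else 0) * ∏ n ∈ Finset.univ.erase k, W (α n))) =
      ENNReal.ofReal (1 / ((N : ℝ) + 1)) * ENNReal.ofReal
        ((if α k = j then 1 else 0) * ∏ n ∈ Finset.univ.erase k, W (α n)) := by
    intro k α
    have h : ∀ ρ : Fin N → State D,
        ENNReal.ofReal (1 / ((N : ℝ) + 1) * p k (fun n => Z (α n)) (k.insertNth ξ ρ) *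
          ((if α k = j then 1 else 0) * ∏ n ∈ Finset.univ.erase k, W (α n))) =
        (ENNReal.ofReal (1 / ((N : ℝ) + 1)) * ENNReal.ofReal
          ((if α k = j then 1 else 0) * ∏ n ∈ Finset.univ.erase k, W (α n))) *
          ENNReal.ofReal (p k (fun n => Z (α n)) (k.insertNth ξ ρ)) := by
      intro ρ
      rw [← ENNReal.ofReal_mul (by positivity),
        ← ENNReal.ofReal_mul (mul_nonneg (by positivity) (hnn k α))]
      congr 1
      ring
    rw [lintegral_congr h, lintegral_const_mul' _ _
      (ENNReal.mul_ne_top ENNReal.ofReal_ne_top ENNReal.ofReal_ne_top), hint, mul_one]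
  simp only [h1, ← Finset.mul_sum]
  simp only [← ENNReal.ofReal_sum_of_nonneg fun α _ => hnn _ α]
  simp only [sum_pi_prod_mul hsum fun i => if i = j then (1 : ℝ) else 0, Finset.sum_ite_eq',
    Finset.mem_univ, if_true, ENNReal.ofReal_one, Finset.sum_const, Finset.card_univ,
    Fintype.card_fin, nsmul_eq_mul]
  rw [mul_one, mul_comm, natCast_succ_mul_ofReal_inv]

/-- This is the cancellation behind backward sampling: averaging the weight of the selected particle
over its ancestor gives `∑ i, W i * q (Z i) x`, the denominator in `backwardProb`, and leaves the
numerator for the earlier index `j`. -/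
lemma sum_lintegral_smoothing_step {q : State D → State D → ℝ} (hq : ∀ y x, 0 < q y x)
    (hqm : ∀ y, Measurable (q y))
    {p : Fin (N + 1) → Particles N D → Particles N D → ℝ}
    (hpm : ∀ k y, Measurable (p k y))
    (hint : ∀ k y x, ∫⁻ r : Fin N → State D, ENNReal.ofReal (p k y (k.insertNth x r)) = 1)
    {W : Fin (N + 1) → ℝ} (hW : ∀ n, 0 < W n) (hsum : ∑ n, W n = 1) (j : Fin (N + 1))
    (Z : Particles N D) {g : State D → ENNReal} (hg : Measurable g) :
    ∑ α : Fin (N + 1) → Fin (N + 1), ∑ l, ∫⁻ ζ : Particles N D,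
      ENNReal.ofReal (q (Z (α l)) (ζ l) * p l (fun n => Z (α n)) ζ / ((N : ℝ) + 1) *
        (∏ n, W (α n)) * backwardProb q W Z (ζ l) j) * g (ζ l) =
      ENNReal.ofReal (W j) * ∫⁻ x, ENNReal.ofReal (q (Z j) x) * g x := by
  have hS : ∀ x, 0 < ∑ n, W n * q (Z n) x := fun x =>
    Finset.sum_pos (fun n _ => mul_pos (hW n) (hq _ _)) Finset.univ_nonempty
  have hbm : Measurable fun x => backwardProb q W Z x j := by
    unfold backwardProb
    exact ((hqm _).const_mul _).div
      (Finset.measurable_fun_sum _ fun n _ => (hqm _).const_mul _)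
  have hc0 : ∀ (α : Fin (N + 1) → Fin (N + 1)) l x,
      0 ≤ q (Z (α l)) x / ((N : ℝ) + 1) * (∏ n, W (α n)) * backwardProb q W Z x j := by
    intro α l x
    exact mul_nonneg (mul_nonneg (div_nonneg (hq _ _).le (by positivity))
      (Finset.prod_nonneg fun n _ => (hW _).le)) (backwardProb_pos hq hW _ _ _).le
  have hcm : ∀ (α : Fin (N + 1) → Fin (N + 1)) l, Measurable fun x => ENNReal.ofReal
      (q (Z (α l)) x / ((N : ℝ) + 1) * (∏ n, W (α n)) * backwardProb q W Z x j) * g x :=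
    fun α l => ((((hqm _).div_const _).mul_const _).mul hbm).ennreal_ofReal.mul hg
  have h1 : ∀ (α : Fin (N + 1) → Fin (N + 1)) l, ∫⁻ ζ : Particles N D,
      ENNReal.ofReal (q (Z (α l)) (ζ l) * p l (fun n => Z (α n)) ζ / ((N : ℝ) + 1) *
        (∏ n, W (α n)) * backwardProb q W Z (ζ l) j) * g (ζ l) =
      ∫⁻ x, ENNReal.ofReal
        (q (Z (α l)) x / ((N : ℝ) + 1) * (∏ n, W (α n)) * backwardProb q W Z x j) * g x := by
    intro α l
    rw [← lintegral_mul_proposal (hpm l fun n => Z (α n)) (hint l _) (hcm α l)]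
    refine lintegral_congr fun ζ => ?_
    rw [mul_right_comm (ENNReal.ofReal _), ← ENNReal.ofReal_mul (hc0 _ _ _)]
    congr 2
    ring
  have h2 : ∀ l x, ∑ α : Fin (N + 1) → Fin (N + 1),
      q (Z (α l)) x / ((N : ℝ) + 1) * (∏ n, W (α n)) * backwardProb q W Z x j =
      1 / ((N : ℝ) + 1) * (W j * q (Z j) x) := by
    intro l x
    have h : ∀ α : Fin (N + 1) → Fin (N + 1),
        q (Z (α l)) x / ((N : ℝ) + 1) * (∏ n, W (α n)) * backwardProb q W Z x j =
        (backwardProb q W Z x j / ((N : ℝ) + 1)) *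
          ((W (α l) * q (Z (α l)) x) * ∏ n ∈ Finset.univ.erase l, W (α n)) := by
      intro α
      rw [← Finset.mul_prod_erase _ _ (Finset.mem_univ l)]
      ring
    -- Only the ancestor of `l` interacts with `q`; its sum is the denominator of `backwardProb`.
    rw [Finset.sum_congr rfl fun α _ => h α, ← Finset.mul_sum,
      sum_pi_prod_mul hsum fun i => W i * q (Z i) x, backwardProb]
    have := (hS x).ne'
    field_simp
  have h3 : ∀ l, ∑ α : Fin (N + 1) → Fin (N + 1), ∫⁻ x, ENNReal.ofReal
        (q (Z (α l)) x / ((N : ℝ) + 1) * (∏ n, W (α n)) * backwardProb q W Z x j) * g x =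
      ENNReal.ofReal (1 / ((N : ℝ) + 1)) *
        (ENNReal.ofReal (W j) * ∫⁻ x, ENNReal.ofReal (q (Z j) x) * g x) := by
    intro l
    rw [← lintegral_finsetSum _ fun α _ => hcm α l, ← lintegral_const_mul' _ _
      ENNReal.ofReal_ne_top, ← lintegral_const_mul' _ _ ENNReal.ofReal_ne_top]
    refine lintegral_congr fun x => ?_
    rw [← Finset.sum_mul, ← ENNReal.ofReal_sum_of_nonneg fun α _ => hc0 α l x, h2,
      ENNReal.ofReal_mul (by positivity), ENNReal.ofReal_mul (hW j).le]
    ring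
  simp only [h1]
  -- The contribution is the same for each of the `N + 1` values of `l`.
  rw [Finset.sum_comm, Finset.sum_congr rfl fun l _ => h3 l, Finset.sum_const, Finset.card_univ,
    Fintype.card_fin, nsmul_eq_mul, ← mul_assoc, natCast_succ_mul_ofReal_inv, one_mul]

end OneStep

/-! ### Recursion in time of the joint densities. -/

section Snoc

variable {S N D : ℕ}

lemma runWeights_snoc_castSucc
    (w : Fin (S + 2) → Particles N D → Particles N D → Fin (N + 1) → ℝ)
    (a : Fin S → Fin (N + 1) → Fin (N + 1)) (α : Fin (N + 1) → Fin (N + 1))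
    (z : Fin (S + 1) → Particles N D) (ζ : Particles N D) (t : Fin (S + 1)) :
    runWeights w (Fin.snoc a α : Fin (S + 1) → Fin (N + 1) → Fin (N + 1))
      (Fin.snoc z ζ : Fin (S + 2) → Particles N D) t.castSucc =
      runWeights (fun t => w t.castSucc) a z t := by
  rw [runWeights, runWeights, ancestors_snoc_castSucc, Fin.snoc_castSucc]

lemma forwardDensity_snoc
    (prop : Fin (S + 2) → Fin (N + 1) → Particles N D → Particles N D → ℝ)
    (w : Fin (S + 2) → Particles N D → Particles N D → Fin (N + 1) → ℝ)
    (k : Fin (S + 1) → Fin (N + 1)) (κ : Fin (N + 1))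
    (a : Fin S → Fin (N + 1) → Fin (N + 1)) (α : Fin (N + 1) → Fin (N + 1))
    (z : Fin (S + 1) → Particles N D) (ζ : Particles N D) :
    forwardDensity prop w (Fin.snoc k κ : Fin (S + 2) → Fin (N + 1))
      (Fin.snoc a α : Fin (S + 1) → Fin (N + 1) → Fin (N + 1))
      (Fin.snoc z ζ : Fin (S + 2) → Particles N D) =
    forwardDensity (fun t => prop t.castSucc) (fun t => w t.castSucc) k a z *
      (1 / ((N : ℝ) + 1) * prop (Fin.last _) κ (fun n => z (Fin.last S) (α n)) ζ *
        ((if α κ = k (Fin.last S) then 1 else 0) * ∏ n ∈ Finset.univ.erase κ,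
          runWeights (fun t => w t.castSucc) a z (Fin.last S) (α n))) := by
  unfold forwardDensity
  conv_lhs => rw [Fin.prod_univ_castSucc (n := S), Fin.prod_univ_castSucc (n := S + 1)]
  simp only [ancestors_snoc_castSucc, ancestors_snoc_last, runWeights_snoc_castSucc,
    Fin.snoc_castSucc, Fin.snoc_last, Fin.succ_last, Fin.succ_castSucc]
  ring

lemma smoothingCore_snoc
    (Q : Fin (S + 2) → State D → State D → ℝ)
    (w : Fin (S + 2) → Particles N D → Particles N D → Fin (N + 1) → ℝ)
    (a : Fin S → Fin (N + 1) → Fin (N + 1)) (α : Fin (N + 1) → Fin (N + 1))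
    (l : Fin (S + 1) → Fin (N + 1)) (μ : Fin (N + 1))
    (z : Fin (S + 1) → Particles N D) (ζ : Particles N D) :
    smoothingCore Q w (Fin.snoc a α : Fin (S + 1) → Fin (N + 1) → Fin (N + 1))
      (Fin.snoc l μ : Fin (S + 2) → Fin (N + 1)) (Fin.snoc z ζ : Fin (S + 2) → Particles N D) =
    smoothingCore (fun t => Q t.castSucc) (fun t => w t.castSucc) a l z *
      ((∑ m, w (Fin.last _) (fun n => z (Fin.last S) (α n)) ζ m) / ((N : ℝ) + 1) *
        (∏ n, runWeights (fun t => w t.castSucc) a z (Fin.last S) (α n)) *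
        backwardProb (Q (Fin.last _)) (runWeights (fun t => w t.castSucc) a z (Fin.last S))
          (z (Fin.last S)) (ζ μ) (l (Fin.last S))) := by
  unfold smoothingCore
  conv_lhs => rw [Fin.prod_univ_castSucc (n := S), Fin.prod_univ_castSucc (n := S),
    Fin.prod_univ_castSucc (n := S + 1)]
  simp only [ancestors_snoc_castSucc, ancestors_snoc_last, runWeights_snoc_castSucc,
    Fin.snoc_castSucc, Fin.snoc_last, Fin.succ_last, Fin.succ_castSucc]
  ring

lemma sum_mul_normalise {w : Fin (N + 1) → ℝ} (hw : ∀ n, 0 < w n) (n : Fin (N + 1)) :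
    (∑ m, w m) * normalise w n = w n := by
  have h : 0 < ∑ n, w n := Finset.sum_pos (fun n _ => hw n) Finset.univ_nonempty
  rw [normalise, mul_div_cancel₀ _ h.ne']

/-- The total weight at the last time times the normalised weight of `μ` is the unnormalised weight
of `μ`. This exposes the factor `Q · prop` that `sum_lintegral_smoothing_step` integrates. -/
lemma smoothingDensity_snoc
    (Q : Fin (S + 2) → State D → State D → ℝ)
    {w : Fin (S + 2) → Particles N D → Particles N D → Fin (N + 1) → ℝ}
    (hw : ∀ t y z n, 0 < w t y z n)
    (a : Fin S → Fin (N + 1) → Fin (N + 1)) (α : Fin (N + 1) → Fin (N + 1))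
    (l : Fin (S + 1) → Fin (N + 1)) (μ : Fin (N + 1))
    (z : Fin (S + 1) → Particles N D) (ζ : Particles N D) :
    smoothingDensity Q w (Fin.snoc a α : Fin (S + 1) → Fin (N + 1) → Fin (N + 1))
      (Fin.snoc l μ : Fin (S + 2) → Fin (N + 1)) (Fin.snoc z ζ : Fin (S + 2) → Particles N D) =
    smoothingCore (fun t => Q t.castSucc) (fun t => w t.castSucc) a l z *
      (w (Fin.last _) (fun n => z (Fin.last S) (α n)) ζ μ / ((N : ℝ) + 1) *
        (∏ n, runWeights (fun t => w t.castSucc) a z (Fin.last S) (α n)) *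
        backwardProb (Q (Fin.last _)) (runWeights (fun t => w t.castSucc) a z (Fin.last S))
          (z (Fin.last S)) (ζ μ) (l (Fin.last S))) := by
  have h : runWeights w (Fin.snoc a α : Fin (S + 1) → Fin (N + 1) → Fin (N + 1))
      (Fin.snoc z ζ : Fin (S + 2) → Particles N D) (Fin.last (S + 1)) =
      normalise (w (Fin.last _) (fun n => z (Fin.last S) (α n)) ζ) := by
    rw [runWeights, ancestors_snoc_last, Fin.snoc_last]
  rw [smoothingDensity, smoothingCore_snoc, h, Fin.snoc_last, ← sum_mul_normalise (hw _ _ _) μ]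
  ring

end Snoc

end ParticleMGRAD

namespace ParticleMGRAD

/-! ### The output law has total mass one. -/

section TotalMass

lemma lintegral_fin_one {E : Type*} [MeasureSpace E] [SigmaFinite (volume : Measure E)]
    (f : (Fin (0 + 1) → E) → ENNReal) : ∫⁻ z, f z = ∫⁻ x, f fun _ => x :=
  ((volume_preserving_funUnique (Fin 1) E).symm.lintegral_comp_emb
    (MeasurableEquiv.measurableEmbedding _) f).symm

lemma sum_fin_one {I R : Type*} [Fintype I] [AddCommMonoid R] (f : (Fin (0 + 1) → I) → R) :
    ∑ a, f a = ∑ i, f fun _ => i :=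
  ((Equiv.funUnique (Fin 1) I).symm.sum_comp f).symm

variable {S N D : ℕ}

lemma runWeights_pos {w : Fin (S + 1) → Particles N D → Particles N D → Fin (N + 1) → ℝ}
    (hw : ∀ t y z n, 0 < w t y z n) (a : Fin S → Fin (N + 1) → Fin (N + 1))
    (z : Fin (S + 1) → Particles N D) (t : Fin (S + 1)) (n : Fin (N + 1)) :
    0 < runWeights w a z t n :=
  normalise_pos (hw _ _ _) n

lemma sum_runWeights {w : Fin (S + 1) → Particles N D → Particles N D → Fin (N + 1) → ℝ}
    (hw : ∀ t y z n, 0 < w t y z n) (a : Fin S → Fin (N + 1) → Fin (N + 1))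
    (z : Fin (S + 1) → Particles N D) (t : Fin (S + 1)) : ∑ n, runWeights w a z t n = 1 :=
  sum_normalise (hw _ _ _)

lemma forwardDensity_nonneg
    {prop : Fin (S + 1) → Fin (N + 1) → Particles N D → Particles N D → ℝ}
    {w : Fin (S + 1) → Particles N D → Particles N D → Fin (N + 1) → ℝ}
    (hprop : ∀ t k y z, 0 < prop t k y z) (hw : ∀ t y z n, 0 < w t y z n)
    (k : Fin (S + 1) → Fin (N + 1)) (a : Fin S → Fin (N + 1) → Fin (N + 1))
    (z : Fin (S + 1) → Particles N D) : 0 ≤ forwardDensity prop w k a z := by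
  refine mul_nonneg (Finset.prod_nonneg fun t _ => mul_nonneg (by positivity) (hprop _ _ _ _).le)
    (Finset.prod_nonneg fun s _ => mul_nonneg (by split_ifs <;> norm_num)
      (Finset.prod_nonneg fun n _ => (normalise_pos (hw _ _ _) _).le))

/-- Induction on the number of time steps. The last step has conditional mass one by
`sum_lintegral_forward_step`, for any history, since earlier weights and ancestors do not see it. -/
theorem sum_lintegral_forwardDensity
    {prop : Fin (S + 1) → Fin (N + 1) → Particles N D → Particles N D → ℝ}
    {w : Fin (S + 1) → Particles N D → Particles N D → Fin (N + 1) → ℝ}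
    (hprop : ∀ t k y z, 0 < prop t k y z)
    (hpropm : ∀ t k, Measurable fun p : Particles N D × Particles N D => prop t k p.1 p.2)
    (hint : ∀ t k y x,
      ∫⁻ r : Fin N → State D, ENNReal.ofReal (prop t k y (k.insertNth x r)) = 1)
    (hw : ∀ t y z n, 0 < w t y z n)
    (hwm : ∀ t n, Measurable fun p : Particles N D × Particles N D => w t p.1 p.2 n)
    (x : Path S D) :
    ∑ k, ∑ a, ∫⁻ r, ENNReal.ofReal (forwardDensity prop w k a (insertPath k x r)) = 1 := by
  induction S with
  | zero =>
    have h : ∀ k (a : Fin 0 → Fin (N + 1) → Fin (N + 1)),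
        ∫⁻ ρ, ENNReal.ofReal (forwardDensity prop w (fun _ => k) a
          (insertPath (fun _ => k) x fun _ => ρ)) = ENNReal.ofReal (1 / ((N : ℝ) + 1)) := by
      intro k a
      simp only [forwardDensity, Finset.univ_eq_empty, Finset.prod_empty, mul_one]
      rw [← mul_one (ENNReal.ofReal _), ← hint 0 k (fun _ => 0) (x 0),
        ← lintegral_const_mul' _ _ ENNReal.ofReal_ne_top]
      refine lintegral_congr fun ρ => ?_
      rw [← ENNReal.ofReal_mul (by positivity)]
      simp only [Nat.reduceAdd, Fin.prod_univ_one, ancestors_zero, insertPath]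
    simp only [sum_fin_one, lintegral_fin_one, h, Finset.univ_unique, Finset.sum_const,
      Finset.card_univ, Fintype.card_fin, Finset.card_singleton, one_smul, nsmul_eq_mul]
    exact natCast_succ_mul_ofReal_inv N
  | succ S ih =>
    have hwm' := fun t : Fin (S + 1) => hwm t.castSucc
    have hpropm' := fun t : Fin (S + 1) => hpropm t.castSucc
    -- The `1` on the right becomes the total mass for the path without its last state, so that both
    -- sides can be compared for each history `k`, `a`, `r`.
    rw [← ih (fun t => hprop t.castSucc) hpropm' (fun t => hint t.castSucc)
      (fun t => hw t.castSucc) hwm' (Fin.init x), sum_fin_snoc]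
    refine Finset.sum_congr rfl fun k _ => ?_
    simp only [sum_fin_snoc (S := S)]
    rw [Finset.sum_comm]
    refine Finset.sum_congr rfl fun a _ => ?_
    have hmeas : ∀ κ α, Measurable fun r : Fin (S + 2) → Fin N → State D =>
        ENNReal.ofReal (forwardDensity prop w (Fin.snoc k κ : Fin (S + 2) → Fin (N + 1))
          (Fin.snoc a α : Fin (S + 1) → Fin (N + 1) → Fin (N + 1))
          (insertPath (Fin.snoc k κ : Fin (S + 2) → Fin (N + 1)) x r)) := fun κ α =>
      ((measurable_forwardDensity hpropm hwm _ _).fun_comp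
        ((measurable_insertPath _).fun_comp (measurable_const.prodMk measurable_id))).ennreal_ofReal
    simp only [fun κ α => lintegral_snoc (hmeas κ α)]
    have hmeas' : ∀ κ α, Measurable fun r : Fin (S + 1) → Fin N → State D => ∫⁻ ρ,
        ENNReal.ofReal (forwardDensity prop w (Fin.snoc k κ : Fin (S + 2) → Fin (N + 1))
          (Fin.snoc a α : Fin (S + 1) → Fin (N + 1) → Fin (N + 1))
          (insertPath (Fin.snoc k κ : Fin (S + 2) → Fin (N + 1)) x
            (Fin.snoc r ρ : Fin (S + 2) → Fin N → State D))) := fun κ α =>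
      ((hmeas κ α).fun_comp measurable_snoc).lintegral_prod_right'
    rw [Finset.sum_congr rfl fun κ _ =>
        (lintegral_finsetSum Finset.univ fun α _ => hmeas' κ α).symm,
      ← lintegral_finsetSum Finset.univ fun κ _ =>
      Finset.measurable_fun_sum Finset.univ fun α _ => hmeas' κ α]
    refine lintegral_congr fun r => ?_
    have hx : x = (Fin.snoc (Fin.init x : Path S D) (x (Fin.last (S + 1))) : Path (S + 1) D) :=
      (Fin.snoc_init_self x).symm
    have hnn := forwardDensity_nonneg (fun t : Fin (S + 1) => hprop t.castSucc)
      (fun t : Fin (S + 1) => hw t.castSucc) k a (insertPath k (Fin.init x) r)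
    have hstep := sum_lintegral_forward_step (hint (Fin.last (S + 1)))
      (runWeights_pos (fun t : Fin (S + 1) => hw t.castSucc) a (insertPath k (Fin.init x) r)
        (Fin.last S))
      (sum_runWeights (fun t : Fin (S + 1) => hw t.castSucc) a (insertPath k (Fin.init x) r)
        (Fin.last S)) (k (Fin.last S))
      (insertPath k (Fin.init x) r (Fin.last S)) (x (Fin.last (S + 1)))
    conv_lhs => rw [hx]
    simp only [insertPath_snoc, forwardDensity_snoc, ENNReal.ofReal_mul hnn]
    simp only [lintegral_const_mul' _ _ (ENNReal.ofReal_ne_top), ← Finset.mul_sum]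
    exact (congrArg _ hstep).trans (mul_one _)

variable {Q : Fin (S + 1) → State D → State D → ℝ}
  {prop : Fin (S + 1) → Fin (N + 1) → Particles N D → Particles N D → ℝ}

lemma IsMarginalScheme.weight_pos (h : IsMarginalScheme Q prop) (t : Fin (S + 1))
    (y z : Particles N D) (n : Fin (N + 1)) : 0 < marginalWeight Q prop t y z n :=
  mul_pos (h.Q_pos _ _ _) (h.prop_pos _ _ _ _)

lemma IsMarginalScheme.measurable_weight (h : IsMarginalScheme Q prop) (t : Fin (S + 1))
    (n : Fin (N + 1)) :
    Measurable fun p : Particles N D × Particles N D => marginalWeight Q prop t p.1 p.2 n := by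
  have h2 : Measurable fun p : Particles N D × Particles N D => (p.1 n, p.2 n) := by fun_prop
  exact ((h.measurable_Q t).fun_comp h2).mul (h.measurable_prop t n)

lemma IsMarginalScheme.measurable_jointDensity (h : IsMarginalScheme Q prop)
    (k : Fin (S + 1) → Fin (N + 1)) (a : Fin S → Fin (N + 1) → Fin (N + 1))
    (l : Fin (S + 1) → Fin (N + 1)) :
    Measurable fun z => jointDensity Q prop (marginalWeight Q prop) k a l z :=
  ParticleMGRAD.measurable_jointDensity h.measurable_Q h.measurable_prop h.measurable_weight k a l

lemma IsMarginalScheme.jointDensity_nonneg (h : IsMarginalScheme Q prop) (hN : 1 ≤ N)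
    (k : Fin (S + 1) → Fin (N + 1)) (a : Fin S → Fin (N + 1) → Fin (N + 1))
    (l : Fin (S + 1) → Fin (N + 1)) (z : Fin (S + 1) → Particles N D) :
    0 ≤ jointDensity Q prop (marginalWeight Q prop) k a l z := by
  rw [jointDensity_eq]
  exact mul_nonneg (forwardDensity_nonneg h.prop_pos h.weight_pos k a z)
    (mul_nonneg (forcedMove_nonneg hN (normalise_pos (h.weight_pos _ _ _))
      (sum_normalise (h.weight_pos _ _ _)) _ _) (Finset.prod_nonneg fun s _ =>
        (backwardProb_pos (h.Q_pos _) (normalise_pos (h.weight_pos _ _ _)) _ _ _).le))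

/-- Given the next output index, each backward draw has mass one, so the output indices sum out in
increasing time order, ending with the forced move. -/
lemma IsMarginalScheme.sum_jointDensity (h : IsMarginalScheme Q prop) (hN : 1 ≤ N)
    (k : Fin (S + 1) → Fin (N + 1)) (a : Fin S → Fin (N + 1) → Fin (N + 1))
    (z : Fin (S + 1) → Particles N D) :
    ∑ l, jointDensity Q prop (marginalWeight Q prop) k a l z =
      forwardDensity prop (marginalWeight Q prop) k a z := by
  simp only [jointDensity_eq]
  rw [← Finset.mul_sum, sum_mul_prod_chain (fun i => forcedMove _ (k (Fin.last S)) i)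
    (fun s i j => backwardProb (Q s.succ) (runWeights (marginalWeight Q prop) a z s.castSucc)
      (z s.castSucc) (z s.succ j) i)
    fun s j => sum_backwardProb (h.Q_pos _) (normalise_pos (h.weight_pos _ _ _)) _ _,
    sum_forcedMove hN (runWeights_pos h.weight_pos _ _ _) (sum_runWeights h.weight_pos _ _ _),
    mul_one]

lemma measurable_insertPath_right (k : Fin (S + 1) → Fin (N + 1)) (x : Path S D) :
    Measurable fun r : Fin (S + 1) → Fin N → State D => insertPath k x r :=
  (measurable_insertPath k).fun_comp (measurable_const.prodMk measurable_id)

theorem IsMarginalScheme.isProbabilityMeasure_csmcLaw (h : IsMarginalScheme Q prop) (hN : 1 ≤ N)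
    (x : Path S D) : IsProbabilityMeasure (csmcLaw Q prop (marginalWeight Q prop) x) := by
  constructor
  rw [← lintegral_one, lintegral_csmcLaw h.measurable_jointDensity x measurable_const]
  refine Eq.trans ?_ (sum_lintegral_forwardDensity h.prop_pos h.measurable_prop h.lintegral_prop
    h.weight_pos h.measurable_weight x)
  refine Finset.sum_congr rfl fun k _ => Finset.sum_congr rfl fun a _ => ?_
  simp only [mul_one]
  rw [← lintegral_finsetSum Finset.univ fun l _ => ((h.measurable_jointDensity k a l).fun_comp
    (measurable_insertPath_right k x)).ennreal_ofReal]
  refine lintegral_congr fun r => ?_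
  rw [← ENNReal.ofReal_sum_of_nonneg fun l _ => h.jointDensity_nonneg hN k a l _,
    h.sum_jointDensity hN]

end TotalMass

end ParticleMGRAD

namespace ParticleMGRAD

/-! ### Invariance of the path measure under a marginal scheme. -/

section Invariance

variable {S N D : ℕ}

/-- The unnormalised density `∏_t Q_t(x_{t-1}, x_t)` of a path. -/
def pathDensity (Q : Fin (S + 1) → State D → State D → ℝ) (x : Path S D) : ℝ :=
  ∏ t, Q t (prevState x t) (x t)

lemma pathDensity_nonneg {Q : Fin (S + 1) → State D → State D → ℝ}
    (hQ : ∀ t y x, 0 < Q t y x) (x : Path S D) : 0 ≤ pathDensity Q x :=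
  Finset.prod_nonneg fun _ _ => (hQ _ _ _).le

lemma measurable_pathDensity {Q : Fin (S + 1) → State D → State D → ℝ}
    (hQ : ∀ t, Measurable fun p : State D × State D => Q t p.1 p.2) :
    Measurable (pathDensity Q) :=
  Finset.measurable_fun_prod _ fun t _ =>
    (hQ t).fun_comp ((measurable_prevState t).prodMk (measurable_pi_apply t))

lemma pathDensity_snoc (Q : Fin (S + 2) → State D → State D → ℝ) (x : Path S D) (ξ : State D) :
    pathDensity Q (Fin.snoc x ξ : Path (S + 1) D) =
      pathDensity (fun t => Q t.castSucc) x * Q (Fin.last _) (x (Fin.last S)) ξ := by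
  simp only [pathDensity]
  rw [Fin.prod_univ_castSucc]
  simp only [prevState_snoc_castSucc, prevState_snoc_last, Fin.snoc_castSucc, Fin.snoc_last]

lemma snoc_select (l : Fin (S + 1) → Fin (N + 1)) (μ : Fin (N + 1))
    (z : Fin (S + 1) → Particles N D) (ζ : Particles N D) :
    (fun t => (Fin.snoc z ζ : Fin (S + 2) → Particles N D) t
      ((Fin.snoc l μ : Fin (S + 2) → Fin (N + 1)) t)) =
    (Fin.snoc (fun t => z t (l t)) (ζ μ) : Path (S + 1) D) := by
  funext t
  cases t using Fin.lastCases with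
  | last => simp only [Fin.snoc_last]
  | cast t => simp only [Fin.snoc_castSucc]

lemma smoothingCore_nonneg {Q : Fin (S + 1) → State D → State D → ℝ}
    {w : Fin (S + 1) → Particles N D → Particles N D → Fin (N + 1) → ℝ}
    (hQ : ∀ t y x, 0 < Q t y x) (hw : ∀ t y z n, 0 < w t y z n)
    (a : Fin S → Fin (N + 1) → Fin (N + 1)) (l : Fin (S + 1) → Fin (N + 1))
    (z : Fin (S + 1) → Particles N D) : 0 ≤ smoothingCore Q w a l z :=
  mul_nonneg (mul_nonneg
    (Finset.prod_nonneg fun _ _ => div_nonneg (Finset.sum_nonneg fun _ _ => (hw _ _ _ _).le)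
      (by positivity))
    (Finset.prod_nonneg fun _ _ => Finset.prod_nonneg fun _ _ => (runWeights_pos hw _ _ _ _).le))
    (Finset.prod_nonneg fun _ _ =>
      (backwardProb_pos (hQ _) (runWeights_pos hw _ _ _) _ _ _).le)

lemma IsMarginalScheme.init {Q : Fin (S + 2) → State D → State D → ℝ}
    {prop : Fin (S + 2) → Fin (N + 1) → Particles N D → Particles N D → ℝ}
    (h : IsMarginalScheme Q prop) :
    IsMarginalScheme (fun t : Fin (S + 1) => Q t.castSucc) (fun t => prop t.castSucc) :=
  ⟨fun t => h.Q_pos t.castSucc, fun t => h.measurable_Q t.castSucc,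
    fun t => h.prop_pos t.castSucc, fun t => h.measurable_prop t.castSucc,
    fun t => h.lintegral_prop t.castSucc⟩

lemma IsMarginalScheme.measurable_prop_right {Q : Fin (S + 1) → State D → State D → ℝ}
    {prop : Fin (S + 1) → Fin (N + 1) → Particles N D → Particles N D → ℝ}
    (h : IsMarginalScheme Q prop) (t : Fin (S + 1)) (k : Fin (N + 1)) (y : Particles N D) :
    Measurable (prop t k y) :=
  (h.measurable_prop t k).fun_comp (measurable_const.prodMk measurable_id)

lemma IsMarginalScheme.measurable_Q_right {Q : Fin (S + 1) → State D → State D → ℝ}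
    {prop : Fin (S + 1) → Fin (N + 1) → Particles N D → Particles N D → ℝ}
    (h : IsMarginalScheme Q prop) (t : Fin (S + 1)) (y : State D) :
    Measurable (Q t y) :=
  (h.measurable_Q t).fun_comp (measurable_const.prodMk measurable_id)

/-- Induction on the number of time steps, for all test functions at once: integrating out the last
step turns `g` into another test function of the shorter path. -/
theorem IsMarginalScheme.sum_lintegral_smoothingDensity
    {Q : Fin (S + 1) → State D → State D → ℝ}
    {prop : Fin (S + 1) → Fin (N + 1) → Particles N D → Particles N D → ℝ}
    (h : IsMarginalScheme Q prop) {g : Path S D → ENNReal} (hg : Measurable g) :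
    ∑ a, ∑ l, ∫⁻ z, ENNReal.ofReal (smoothingDensity Q (marginalWeight Q prop) a l z) *
      g (fun t => z t (l t)) = ∫⁻ x, ENNReal.ofReal (pathDensity Q x) * g x := by
  induction S with
  | zero =>
    have hgm : Measurable fun x : State D => g fun _ => x := hg.comp (by fun_prop)
    have hc : Measurable fun x : State D => ENNReal.ofReal (1 / ((N : ℝ) + 1)) *
        (ENNReal.ofReal (Q 0 0 x) * g fun _ => x) :=
      ((h.measurable_Q_right 0 0).ennreal_ofReal.mul hgm).const_mul _
    have h1 : ∀ (a : Fin 0 → Fin (N + 1) → Fin (N + 1)) l, ∫⁻ ζ : Particles N D,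
        ENNReal.ofReal (smoothingDensity Q (marginalWeight Q prop) a (fun _ => l) fun _ => ζ) *
          g (fun _ => ζ l) = ∫⁻ x, ENNReal.ofReal (1 / ((N : ℝ) + 1)) *
            (ENNReal.ofReal (Q 0 0 x) * g fun _ => x) := by
      intro a l
      rw [← lintegral_mul_proposal (h.measurable_prop_right 0 l fun _ => 0)
        (h.lintegral_prop 0 l _) hc]
      refine lintegral_congr fun ζ => ?_
      have h2 : smoothingDensity Q (marginalWeight Q prop) a (fun _ => l) (fun _ => ζ) =
          1 / ((N : ℝ) + 1) * (Q 0 0 (ζ l) * prop 0 l (fun _ => 0) ζ) := by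
        have h3 := sum_mul_normalise (h.weight_pos 0 (fun _ => 0) ζ) l
        rw [marginalWeight] at h3
        rw [← h3]
        simp only [smoothingDensity, smoothingCore, Finset.univ_eq_empty, Finset.prod_empty,
          mul_one, Nat.reduceAdd, Fin.prod_univ_one, runWeights, ancestors_zero]
        have h4 : Fin.last 0 = 0 := rfl
        rw [h4, ancestors_zero]
        ring
      rw [h2, ENNReal.ofReal_mul (by positivity), ENNReal.ofReal_mul (h.Q_pos _ _ _).le]
      ring
    simp only [sum_fin_one, lintegral_fin_one, h1, Finset.univ_unique, Finset.sum_const,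
      Finset.card_univ, Fintype.card_fin, Finset.card_singleton, one_smul, nsmul_eq_mul]
    rw [lintegral_const_mul' _ _ ENNReal.ofReal_ne_top, ← mul_assoc,
      natCast_succ_mul_ofReal_inv, one_mul]
    refine lintegral_congr fun x => ?_
    simp only [pathDensity, Nat.reduceAdd, Fin.prod_univ_one, prevState_zero]
  | succ S ih =>
    set w := marginalWeight Q prop
    have hw : ∀ t y z n, 0 < w t y z n := h.weight_pos
    -- This is the test function for the shorter path: the last state is integrated against `Q`.
    have hg' : Measurable fun x : Path S D => ∫⁻ ξ,
        ENNReal.ofReal (Q (Fin.last _) (x (Fin.last S)) ξ) *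
          g (Fin.snoc x ξ : Path (S + 1) D) := by
      have h2 : Measurable fun p : Path S D × State D => (p.1 (Fin.last S), p.2) := by fun_prop
      have h3 : Measurable fun p : Path S D × State D =>
          ENNReal.ofReal (Q (Fin.last _) (p.1 (Fin.last S)) p.2) *
            g (Fin.snoc p.1 p.2 : Path (S + 1) D) :=
        ((h.measurable_Q (Fin.last _)).fun_comp h2).ennreal_ofReal.mul
          (hg.fun_comp measurable_snoc)
      exact h3.lintegral_prod_right'
    have hR : ∫⁻ x : Path (S + 1) D, ENNReal.ofReal (pathDensity Q x) * g x =
        ∫⁻ x : Path S D, ENNReal.ofReal (pathDensity (fun t => Q t.castSucc) x) *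
          ∫⁻ ξ, ENNReal.ofReal (Q (Fin.last _) (x (Fin.last S)) ξ) *
            g (Fin.snoc x ξ : Path (S + 1) D) := by
      refine (lintegral_snoc ((measurable_pathDensity h.measurable_Q).ennreal_ofReal.mul
        hg)).trans (lintegral_congr fun x => ?_)
      simp only [Pi.mul_apply]
      rw [← lintegral_const_mul' _ _ ENNReal.ofReal_ne_top]
      refine lintegral_congr fun ξ => ?_
      rw [pathDensity_snoc, ENNReal.ofReal_mul (pathDensity_nonneg (fun t => h.Q_pos _) _),
        mul_assoc]
    rw [hR, ← ih h.init hg', sum_fin_snoc]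
    refine Finset.sum_congr rfl fun a _ => ?_
    simp only [sum_fin_snoc (S := S + 1)]
    rw [Finset.sum_comm]
    refine Finset.sum_congr rfl fun l _ => ?_
    have hmeas : ∀ α μ, Measurable fun z : Fin (S + 2) → Particles N D =>
        ENNReal.ofReal (smoothingDensity Q w
          (Fin.snoc a α : Fin (S + 1) → Fin (N + 1) → Fin (N + 1))
          (Fin.snoc l μ : Fin (S + 2) → Fin (N + 1)) z) *
        g fun t => z t ((Fin.snoc l μ : Fin (S + 2) → Fin (N + 1)) t) := fun α μ =>
      (measurable_smoothingDensity h.measurable_Q h.measurable_weight _ _).ennreal_ofReal.mul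
        (hg.fun_comp (by fun_prop))
    simp only [fun α μ => lintegral_snoc (hmeas α μ)]
    have hmeas' : ∀ α μ, Measurable fun z : Fin (S + 1) → Particles N D => ∫⁻ ζ,
        ENNReal.ofReal (smoothingDensity Q w
          (Fin.snoc a α : Fin (S + 1) → Fin (N + 1) → Fin (N + 1))
          (Fin.snoc l μ : Fin (S + 2) → Fin (N + 1))
          (Fin.snoc z ζ : Fin (S + 2) → Particles N D)) *
        g fun t => (Fin.snoc z ζ : Fin (S + 2) → Particles N D) t
          ((Fin.snoc l μ : Fin (S + 2) → Fin (N + 1)) t) := fun α μ =>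
      ((hmeas α μ).fun_comp measurable_snoc).lintegral_prod_right'
    rw [Finset.sum_congr rfl fun α _ =>
        (lintegral_finsetSum Finset.univ fun μ _ => hmeas' α μ).symm,
      ← lintegral_finsetSum Finset.univ fun α _ =>
        Finset.measurable_fun_sum Finset.univ fun μ _ => hmeas' α μ]
    refine lintegral_congr fun z => ?_
    have hnn : 0 ≤ smoothingCore (fun t : Fin (S + 1) => Q t.castSucc) (fun t => w t.castSucc)
        a l z := smoothingCore_nonneg (fun t => h.Q_pos _) (fun t => h.weight_pos _) a l z
    have hstep := sum_lintegral_smoothing_step (h.Q_pos (Fin.last _))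
      (h.measurable_Q_right (Fin.last _)) (h.measurable_prop_right (Fin.last _))
      (h.lintegral_prop (Fin.last _)) (runWeights_pos h.init.weight_pos a z (Fin.last S))
      (sum_runWeights h.init.weight_pos a z (Fin.last S)) (l (Fin.last S)) (z (Fin.last S))
      (g := fun ξ => g (Fin.snoc (fun t => z t (l t)) ξ : Path (S + 1) D))
      (hg.fun_comp (measurable_snoc.fun_comp (measurable_const.prodMk measurable_id)))
    simp only [snoc_select, smoothingDensity_snoc Q hw, ENNReal.ofReal_mul hnn,
      mul_assoc (ENNReal.ofReal (smoothingCore _ _ a l z))]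
    simp only [lintegral_const_mul' _ _ (ENNReal.ofReal_ne_top), ← Finset.mul_sum]
    -- The one-step integral leaves the weight of the last remaining output index, which completes
    -- `smoothingCore` to the `smoothingDensity` of the shorter problem.
    refine (congrArg _ hstep).trans ?_
    rw [smoothingDensity, ENNReal.ofReal_mul (smoothingCore_nonneg (fun t => h.Q_pos _)
      h.init.weight_pos a l z), mul_assoc]
    rfl

/-- On the right only the last line involves `k`: it says that `k_T` is drawn from the final weights
and that the earlier `k_t` are its ancestors. This is where the choice `w = Q · prop` is used. -/
lemma IsMarginalScheme.pathDensity_mul_forwardDensity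
    {Q : Fin (S + 1) → State D → State D → ℝ}
    {prop : Fin (S + 1) → Fin (N + 1) → Particles N D → Particles N D → ℝ}
    (h : IsMarginalScheme Q prop) (k : Fin (S + 1) → Fin (N + 1))
    (a : Fin S → Fin (N + 1) → Fin (N + 1)) (z : Fin (S + 1) → Particles N D) :
    pathDensity Q (fun t => z t (k t)) * forwardDensity prop (marginalWeight Q prop) k a z =
      (∏ t, (∑ m, marginalWeight Q prop t (ancestors a z t) (z t) m) / ((N : ℝ) + 1)) *
      (∏ s : Fin S, ∏ n, runWeights (marginalWeight Q prop) a z s.castSucc (a s n)) *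
      (runWeights (marginalWeight Q prop) a z (Fin.last S) (k (Fin.last S)) *
        ∏ s : Fin S, (if a s (k s.succ) = k s.castSucc then 1 else 0)) := by
  by_cases hk : ∀ s : Fin S, a s (k s.succ) = k s.castSucc
  · have hprev : ∀ t, prevState (fun t => z t (k t)) t = ancestors a z t (k t) := by
      intro t
      cases t using Fin.cases with
      -- The dummies of `prevState` and `ancestors` at the first time are both `0`.
      | zero => rfl
      | succ s => simp only [prevState_succ, ancestors_succ, hk]
    have h1 : pathDensity Q (fun t => z t (k t)) *
        ∏ t, 1 / ((N : ℝ) + 1) * prop t (k t) (ancestors a z t) (z t) =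
        (∏ t, (∑ m, marginalWeight Q prop t (ancestors a z t) (z t) m) / ((N : ℝ) + 1)) *
          ∏ t, runWeights (marginalWeight Q prop) a z t (k t) := by
      rw [pathDensity, ← Finset.prod_mul_distrib, ← Finset.prod_mul_distrib]
      refine Finset.prod_congr rfl fun t _ => ?_
      have h3 := sum_mul_normalise (h.weight_pos t (ancestors a z t) (z t)) (k t)
      rw [runWeights, hprev, div_mul_eq_mul_div (∑ m, _), h3, marginalWeight]
      ring
    simp only [forwardDensity, hk, if_true, one_mul, Finset.prod_const_one, mul_one]
    rw [← mul_assoc, h1, Fin.prod_univ_castSucc (n := S)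
      (f := fun t => runWeights (marginalWeight Q prop) a z t (k t))]
    -- The weight of the reference particle at time `s.castSucc` is the ancestor probability that
    -- `forwardDensity` omits for the reference particle at time `s.succ`.
    have h2 : ∀ s : Fin S, ∏ n, runWeights (marginalWeight Q prop) a z s.castSucc (a s n) =
        runWeights (marginalWeight Q prop) a z s.castSucc (k s.castSucc) *
          ∏ n ∈ Finset.univ.erase (k s.succ),
            runWeights (marginalWeight Q prop) a z s.castSucc (a s n) := by
      intro s
      rw [← Finset.mul_prod_erase _ _ (Finset.mem_univ (k s.succ)), hk]
    simp only [h2, Finset.prod_mul_distrib]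
    ring
  -- Off the ancestral line both sides vanish through the indicators.
  · obtain ⟨s, hs⟩ := not_forall.1 hk
    have h1 : ∏ s : Fin S, (if a s (k s.succ) = k s.castSucc then (1 : ℝ) else 0) = 0 :=
      Finset.prod_eq_zero (Finset.mem_univ s) (if_neg hs)
    rw [forwardDensity, Finset.prod_mul_distrib (s := Finset.univ) (ι := Fin S), h1]
    ring

/-- The earlier reference indices are determined by `k_T`, and averaging the forced move over `k_T`
with law `W_T` returns `W_T`, now evaluated at the output index. -/
lemma IsMarginalScheme.sum_pathDensity_mul_jointDensity
    {Q : Fin (S + 1) → State D → State D → ℝ}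
    {prop : Fin (S + 1) → Fin (N + 1) → Particles N D → Particles N D → ℝ}
    (h : IsMarginalScheme Q prop) (hN : 1 ≤ N)
    (a : Fin S → Fin (N + 1) → Fin (N + 1)) (l : Fin (S + 1) → Fin (N + 1))
    (z : Fin (S + 1) → Particles N D) :
    ∑ k : Fin (S + 1) → Fin (N + 1), pathDensity Q (fun t => z t (k t)) *
      jointDensity Q prop (marginalWeight Q prop) k a l z =
      smoothingDensity Q (marginalWeight Q prop) a l z := by
  have h1 : ∀ k : Fin (S + 1) → Fin (N + 1), pathDensity Q (fun t => z t (k t)) *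
      jointDensity Q prop (marginalWeight Q prop) k a l z =
      smoothingCore Q (marginalWeight Q prop) a l z *
        ((forcedMove (runWeights (marginalWeight Q prop) a z (Fin.last S)) (k (Fin.last S))
          (l (Fin.last S)) *
          runWeights (marginalWeight Q prop) a z (Fin.last S) (k (Fin.last S))) *
        ∏ s : Fin S, (if a s (k s.succ) = k s.castSucc then 1 else 0)) := by
    intro k
    rw [jointDensity_eq, ← mul_assoc, h.pathDensity_mul_forwardDensity, smoothingCore]
    ring
  rw [Finset.sum_congr rfl fun k _ => h1 k, ← Finset.mul_sum,
    sum_mul_prod_chain (fun i => forcedMove (runWeights (marginalWeight Q prop) a z (Fin.last S)) i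
      (l (Fin.last S)) * runWeights (marginalWeight Q prop) a z (Fin.last S) i)
      (fun s i j => if a s j = i then 1 else 0) (fun s j => by simp),
    sum_mul_forcedMove hN (runWeights_pos h.weight_pos _ _ _) (sum_runWeights h.weight_pos _ _ _),
    smoothingDensity]

lemma measurable_select (l : Fin (S + 1) → Fin (N + 1)) :
    Measurable fun (z : Fin (S + 1) → Particles N D) t => z t (l t) := by fun_prop

lemma IsMarginalScheme.measurable_lintegral_csmcLaw
    {Q : Fin (S + 1) → State D → State D → ℝ}
    {prop : Fin (S + 1) → Fin (N + 1) → Particles N D → Particles N D → ℝ}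
    (h : IsMarginalScheme Q prop) {g : Path S D → ENNReal} (hg : Measurable g) :
    Measurable fun x => ∫⁻ x', g x' ∂csmcLaw Q prop (marginalWeight Q prop) x := by
  simp only [fun x => lintegral_csmcLaw h.measurable_jointDensity x hg]
  refine Finset.measurable_fun_sum _ fun k _ => Finset.measurable_fun_sum _ fun a _ =>
    Finset.measurable_fun_sum _ fun l _ => ?_
  have h1 : Measurable fun z => ENNReal.ofReal
      (jointDensity Q prop (marginalWeight Q prop) k a l z) * g fun t => z t (l t) :=
    (h.measurable_jointDensity k a l).ennreal_ofReal.mul (hg.fun_comp (measurable_select l))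
  exact (h1.fun_comp (measurable_insertPath k)).lintegral_prod_right'

/-- Tonelli: the reference path and the remaining particles merge into one Lebesgue integral over
full arrays, under which the reference indices are summed out. -/
theorem IsMarginalScheme.lintegral_pathDensity_mul_csmcLaw
    {Q : Fin (S + 1) → State D → State D → ℝ}
    {prop : Fin (S + 1) → Fin (N + 1) → Particles N D → Particles N D → ℝ}
    (h : IsMarginalScheme Q prop) (hN : 1 ≤ N) {g : Path S D → ENNReal} (hg : Measurable g) :
    ∫⁻ x, ENNReal.ofReal (pathDensity Q x) *
      ∫⁻ x', g x' ∂csmcLaw Q prop (marginalWeight Q prop) x =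
      ∫⁻ x, ENNReal.ofReal (pathDensity Q x) * g x := by
  rw [← h.sum_lintegral_smoothingDensity hg]
  set J := fun k a l z => jointDensity Q prop (marginalWeight Q prop) k a l z with hJ
  have hmP := (measurable_pathDensity h.measurable_Q).ennreal_ofReal
  have hm : ∀ k a l, Measurable fun z : Fin (S + 1) → Particles N D =>
      ENNReal.ofReal (pathDensity Q fun t => z t (k t)) *
        (ENNReal.ofReal (J k a l z) * g fun t => z t (l t)) := fun k a l =>
    (hmP.fun_comp (measurable_select k)).mul
      ((h.measurable_jointDensity k a l).ennreal_ofReal.mul (hg.fun_comp (measurable_select l)))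
  have h1 : ∀ x : Path S D, ENNReal.ofReal (pathDensity Q x) *
      ∫⁻ x', g x' ∂csmcLaw Q prop (marginalWeight Q prop) x =
      ∑ k, ∑ a, ∑ l, ∫⁻ r, (fun z : Fin (S + 1) → Particles N D =>
        ENNReal.ofReal (pathDensity Q fun t => z t (k t)) *
        (ENNReal.ofReal (J k a l z) * g fun t => z t (l t))) (insertPath k x r) := by
    intro x
    rw [lintegral_csmcLaw h.measurable_jointDensity x hg]
    -- `pathDensity Q x` must become a function of the whole array; the path `x` is recovered by
    -- reading the array at the indices `k`.
    simp only [Finset.mul_sum, insertPath_apply_self]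
    refine Finset.sum_congr rfl fun k _ => Finset.sum_congr rfl fun a _ =>
      Finset.sum_congr rfl fun l _ => ?_
    rw [← lintegral_const_mul' _ _ ENNReal.ofReal_ne_top]
  have hmx : ∀ k a l, Measurable fun x : Path S D => ∫⁻ r,
      (fun z : Fin (S + 1) → Particles N D =>
        ENNReal.ofReal (pathDensity Q fun t => z t (k t)) *
        (ENNReal.ofReal (J k a l z) * g fun t => z t (l t))) (insertPath k x r) := fun k a l =>
    ((hm k a l).fun_comp (measurable_insertPath k)).lintegral_prod_right'
  rw [lintegral_congr h1, lintegral_finsetSum _ fun k _ => Finset.measurable_fun_sum _ fun a _ =>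
    Finset.measurable_fun_sum _ fun l _ => hmx k a l]
  have h2 : ∀ k : Fin (S + 1) → Fin (N + 1), ∫⁻ x : Path S D, ∑ a, ∑ l, ∫⁻ r,
      (fun z : Fin (S + 1) → Particles N D =>
        ENNReal.ofReal (pathDensity Q fun t => z t (k t)) *
        (ENNReal.ofReal (J k a l z) * g fun t => z t (l t))) (insertPath k x r) =
      ∑ a, ∑ l, ∫⁻ z, ENNReal.ofReal (pathDensity Q fun t => z t (k t)) *
        (ENNReal.ofReal (J k a l z) * g fun t => z t (l t)) := by
    intro k
    rw [lintegral_finsetSum _ fun a _ => Finset.measurable_fun_sum _ fun l _ => hmx k a l]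
    refine Finset.sum_congr rfl fun a _ => ?_
    rw [lintegral_finsetSum _ fun l _ => hmx k a l]
    exact Finset.sum_congr rfl fun l _ => lintegral_insertPath k (hm k a l)
  rw [Finset.sum_congr rfl fun k _ => h2 k, Finset.sum_comm]
  refine Finset.sum_congr rfl fun a _ => ?_
  rw [Finset.sum_comm]
  refine Finset.sum_congr rfl fun l _ => ?_
  rw [← lintegral_finsetSum _ fun k _ => hm k a l]
  refine lintegral_congr fun z => ?_
  rw [← h.sum_pathDensity_mul_jointDensity hN, ENNReal.ofReal_sum_of_nonneg fun k _ =>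
    mul_nonneg (pathDensity_nonneg h.Q_pos _) (h.jointDensity_nonneg hN k a l z), Finset.sum_mul]
  refine Finset.sum_congr rfl fun k _ => ?_
  rw [ENNReal.ofReal_mul (pathDensity_nonneg h.Q_pos _), mul_assoc]

/-- The Markov kernel of the algorithm. -/
noncomputable def IsMarginalScheme.kernel {Q : Fin (S + 1) → State D → State D → ℝ}
    {prop : Fin (S + 1) → Fin (N + 1) → Particles N D → Particles N D → ℝ}
    (h : IsMarginalScheme Q prop) : Kernel (Path S D) (Path S D) where
  toFun := csmcLaw Q prop (marginalWeight Q prop)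
  measurable' := Measure.measurable_of_measurable_coe _ fun s hs => by
    have h1 := h.measurable_lintegral_csmcLaw (measurable_one.indicator hs)
    simpa only [lintegral_indicator_one hs] using h1

theorem IsMarginalScheme.invariant_kernel {Q : Fin (S + 1) → State D → State D → ℝ}
    {prop : Fin (S + 1) → Fin (N + 1) → Particles N D → Particles N D → ℝ}
    (h : IsMarginalScheme Q prop) (hN : 1 ≤ N) (c : ENNReal) :
    h.kernel.Invariant
      (c • volume.withDensity fun x => ENNReal.ofReal (pathDensity Q x)) := by
  have hmP := (measurable_pathDensity h.measurable_Q).ennreal_ofReal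
  refine Measure.ext fun s hs => ?_
  rw [Measure.bind_apply hs h.kernel.measurable.aemeasurable, lintegral_smul_measure,
    Measure.smul_apply, lintegral_withDensity_eq_lintegral_mul _ hmP (h.kernel.measurable_coe hs),
    withDensity_apply _ hs]
  congr 1
  have h1 := h.lintegral_pathDensity_mul_csmcLaw hN (measurable_one.indicator hs)
  simp only [lintegral_indicator_one hs] at h1
  refine h1.trans ?_
  rw [← lintegral_indicator hs]
  refine lintegral_congr fun x => ?_
  by_cases hx : x ∈ s <;> simp [hx]

end Invariance

end ParticleMGRAD

namespace ParticleMGRAD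

/-! ### The generic marginal proposal defines a marginal scheme. -/

section GenericProposal

variable {S N D : ℕ}

lemma prod_erase_eq_prod_succAbove {R : Type*} [CommMonoid R] (k : Fin (N + 1))
    (f : Fin (N + 1) → R) : ∏ n ∈ Finset.univ.erase k, f n = ∏ i : Fin N, f (k.succAbove i) := by
  have h : Finset.univ.erase k = Finset.univ.image k.succAbove := by
    ext n
    simp only [Finset.mem_erase, Finset.mem_univ, and_true, Finset.mem_image, true_and]
    exact Fin.exists_succAbove_eq_iff.symm
  rw [h, Finset.prod_image fun _ _ _ _ hij => Fin.succAbove_right_injective hij]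

lemma lintegral_prod_gaussDensity {C : Matrix (Fin D) (Fin D) ℝ} (hC : C.PosDef)
    (m : Fin N → State D) :
    ∫⁻ r : Fin N → State D, ENNReal.ofReal (∏ i, gaussDensity (m i) C (r i)) = 1 := by
  have hi : Integrable fun r : Fin N → State D => ∏ i, gaussDensity (m i) C (r i) :=
    Integrable.fintype_prod fun i => integrable_gaussDensity hC (m i)
  rw [← ofReal_integral_eq_lintegral_ofReal hi
    (ae_of_all _ fun r => Finset.prod_nonneg fun i _ => (gaussDensity_pos hC _ _).le),
    integral_fintype_prod_volume_eq_prod fun i => gaussDensity (m i) C]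
  simp only [integral_gaussDensity hC, Finset.prod_const_one, ENNReal.ofReal_one]

variable {φ : Fin (S + 1) → State D → State D → State D} {v : Fin (S + 1) → State D → State D}
  {H Dm E : Fin (S + 1) → Matrix (Fin D) (Fin D) ℝ}

/-- An integrable Gaussian in `u` times factors bounded by their peak values. -/
lemma integrable_genericProposal (hD : ∀ t, (Dm t).PosDef) (hE : ∀ t, (E t).PosDef)
    (t : Fin (S + 1)) (k : Fin (N + 1)) (y z : Particles N D) :
    Integrable fun u : State D => gaussDensity (z k + φ t (y k) (z k)) (E t) u *
      ∏ n ∈ Finset.univ.erase k, gaussDensity (v t (y n) + H t *ᵥ u) (Dm t) (z n) := by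
  refine (integrable_gaussDensity (hE t) _).mul_bdd
    (c := ∏ n ∈ Finset.univ.erase k, (Real.sqrt ((2 * Real.pi) ^ D * (Dm t).det))⁻¹) ?_
    (ae_of_all _ fun u => ?_)
  · exact (Finset.measurable_fun_prod _ fun _ _ => by fun_prop).aestronglyMeasurable
  · rw [Real.norm_of_nonneg (Finset.prod_nonneg fun _ _ => (gaussDensity_pos (hD t) _ _).le)]
    exact Finset.prod_le_prod (fun _ _ => (gaussDensity_pos (hD t) _ _).le)
      fun _ _ => gaussDensity_le (hD t) _ _

lemma genericProposal_integrand_pos (hD : ∀ t, (Dm t).PosDef) (hE : ∀ t, (E t).PosDef)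
    (t : Fin (S + 1)) (k : Fin (N + 1)) (y z : Particles N D) (u : State D) :
    0 < gaussDensity (z k + φ t (y k) (z k)) (E t) u *
      ∏ n ∈ Finset.univ.erase k, gaussDensity (v t (y n) + H t *ᵥ u) (Dm t) (z n) :=
  mul_pos (gaussDensity_pos (hE t) _ _)
    (Finset.prod_pos fun _ _ => gaussDensity_pos (hD t) _ _)

lemma genericProposal_pos (hD : ∀ t, (Dm t).PosDef) (hE : ∀ t, (E t).PosDef)
    (t : Fin (S + 1)) (k : Fin (N + 1)) (y z : Particles N D) :
    0 < genericProposal φ v H Dm E t k y z := by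
  have hpos := genericProposal_integrand_pos (φ := φ) (v := v) (H := H) hD hE t k y z
  unfold genericProposal
  rw [integral_pos_iff_support_of_nonneg (fun u => (hpos u).le)
    (integrable_genericProposal hD hE t k y z),
    Set.eq_univ_of_forall fun u => Function.mem_support.2 (hpos u).ne']
  exact Measure.measure_univ_pos.2 (NeZero.ne _)

lemma measurable_genericProposal
    (hφ : ∀ t, Measurable fun p : State D × State D => φ t p.1 p.2)
    (hv : ∀ t, Measurable (v t)) (t : Fin (S + 1)) (k : Fin (N + 1)) :
    Measurable fun p : Particles N D × Particles N D =>
      genericProposal φ v H Dm E t k p.1 p.2 := by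
  unfold genericProposal
  refine StronglyMeasurable.measurable ?_
  have h1 : Measurable fun p : (Particles N D × Particles N D) × State D =>
      φ t (p.1.1 k) (p.1.2 k) := by
    have h2 : Measurable fun p : (Particles N D × Particles N D) × State D =>
      (p.1.1 k, p.1.2 k) := by fun_prop
    exact (hφ t).fun_comp h2
  have h3 : ∀ n, Measurable fun p : (Particles N D × Particles N D) × State D =>
      v t (p.1.1 n) := fun n => (hv t).fun_comp (by fun_prop)
  have h4 : Measurable fun p : (Particles N D × Particles N D) × State D =>
      gaussDensity (p.1.2 k + φ t (p.1.1 k) (p.1.2 k)) (E t) p.2 *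
        ∏ n ∈ Finset.univ.erase k,
          gaussDensity (v t (p.1.1 n) + H t *ᵥ p.2) (Dm t) (p.1.2 n) := by
    refine Measurable.mul ?_ (Finset.measurable_fun_prod _ fun n _ => ?_)
    · exact measurable_gaussDensity_comp _ (Measurable.add (by fun_prop) h1) (by fun_prop)
    · exact measurable_gaussDensity_comp _ ((h3 n).add (measurable_mulVec _ measurable_snd))
        (by fun_prop)
  exact h4.stronglyMeasurable.integral_prod_right'

/-- By Tonelli the particles are integrated before `u`: given `u` they are independent Gaussians of
mass one. -/
lemma lintegral_genericProposal (hD : ∀ t, (Dm t).PosDef) (hE : ∀ t, (E t).PosDef)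
    (t : Fin (S + 1)) (k : Fin (N + 1)) (y : Particles N D) (x : State D) :
    ∫⁻ r : Fin N → State D,
      ENNReal.ofReal (genericProposal φ v H Dm E t k y (k.insertNth x r)) = 1 := by
  have h1 : ∀ r : Fin N → State D,
      ENNReal.ofReal (genericProposal φ v H Dm E t k y (k.insertNth x r)) =
      ∫⁻ u, ENNReal.ofReal (gaussDensity (x + φ t (y k) x) (E t) u) *
        ENNReal.ofReal (∏ i, gaussDensity (v t (y (k.succAbove i)) + H t *ᵥ u) (Dm t) (r i)) := by
    intro r
    unfold genericProposal
    rw [ofReal_integral_eq_lintegral_ofReal (integrable_genericProposal hD hE t k y _)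
      (ae_of_all _ fun u => (genericProposal_integrand_pos hD hE t k y _ u).le)]
    refine lintegral_congr fun u => ?_
    rw [ENNReal.ofReal_mul (gaussDensity_pos (hE t) _ _).le, prod_erase_eq_prod_succAbove]
    simp only [Fin.insertNth_apply_same, Fin.insertNth_apply_succAbove]
  rw [lintegral_congr h1, lintegral_lintegral_swap]
  · simp only [lintegral_const_mul' _ _ ENNReal.ofReal_ne_top,
      lintegral_prod_gaussDensity (hD t), mul_one, lintegral_gaussDensity (hE t)]
  · have h2 : Measurable fun p : (Fin N → State D) × State D =>
        ENNReal.ofReal (gaussDensity (x + φ t (y k) x) (E t) p.2) := by fun_prop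
    have h3 : Measurable fun p : (Fin N → State D) × State D => ENNReal.ofReal
        (∏ i, gaussDensity (v t (y (k.succAbove i)) + H t *ᵥ p.2) (Dm t) (p.1 i)) :=
      (Finset.measurable_fun_prod _ fun i _ => measurable_gaussDensity_comp _
        (measurable_const.add (measurable_mulVec _ measurable_snd)) (by fun_prop)).ennreal_ofReal
    exact (h2.mul h3).aemeasurable

theorem isMarginalScheme_generic {Q : Fin (S + 1) → State D → State D → ℝ}
    (hQ : ∀ t y x, 0 < Q t y x)
    (hQm : ∀ t, Measurable fun p : State D × State D => Q t p.1 p.2)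
    (hφ : ∀ t, Measurable fun p : State D × State D => φ t p.1 p.2)
    (hv : ∀ t, Measurable (v t)) (hD : ∀ t, (Dm t).PosDef) (hE : ∀ t, (E t).PosDef) :
    IsMarginalScheme Q (genericProposal (N := N) φ v H Dm E) where
  Q_pos := hQ
  measurable_Q := hQm
  prop_pos := genericProposal_pos hD hE
  measurable_prop := measurable_genericProposal hφ hv
  lintegral_prop := lintegral_genericProposal hD hE

end GenericProposal

/-! ### Quadratic forms and matrix identities for `A_t`. -/

section MatrixIdentities

variable {D : ℕ}

lemma dotProduct_mulVec_symm {M : Matrix (Fin D) (Fin D) ℝ} (hM : Mᵀ = M) (x y : State D) :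
    x ⬝ᵥ (M *ᵥ y) = y ⬝ᵥ (M *ᵥ x) := by
  rw [dotProduct_mulVec, ← mulVec_transpose, hM, dotProduct_comm]

lemma quadratic_sub {M : Matrix (Fin D) (Fin D) ℝ} (hM : Mᵀ = M) (x y : State D) :
    (x - y) ⬝ᵥ (M *ᵥ (x - y)) = x ⬝ᵥ (M *ᵥ x) - 2 * (x ⬝ᵥ (M *ᵥ y)) + y ⬝ᵥ (M *ᵥ y) := by
  simp only [mulVec_sub, sub_dotProduct, dotProduct_sub]
  rw [dotProduct_mulVec_symm hM y x]
  ring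

lemma quadratic_add {M : Matrix (Fin D) (Fin D) ℝ} (hM : Mᵀ = M) (x y : State D) :
    (x + y) ⬝ᵥ (M *ᵥ (x + y)) = x ⬝ᵥ (M *ᵥ x) + 2 * (x ⬝ᵥ (M *ᵥ y)) + y ⬝ᵥ (M *ᵥ y) := by
  simp only [mulVec_add, add_dotProduct, dotProduct_add]
  rw [dotProduct_mulVec_symm hM y x]
  ring

lemma PosDef.transpose_eq {M : Matrix (Fin D) (Fin D) ℝ} (hM : M.PosDef) : Mᵀ = M := by
  rw [← conjTranspose_eq_transpose_of_trivial]
  exact hM.isHermitian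

lemma PosDef.isUnit_det {M : Matrix (Fin D) (Fin D) ℝ} (hM : M.PosDef) : IsUnit M.det :=
  isUnit_iff_ne_zero.2 hM.det_pos.ne'

lemma smul_inv_of_ne_zero {h : ℝ} (hh : h ≠ 0) {M : Matrix (Fin D) (Fin D) ℝ}
    (hM : IsUnit M.det) : (h • M)⁻¹ = h⁻¹ • M⁻¹ := by
  refine inv_eq_right_inv ?_
  rw [Matrix.smul_mul, Matrix.mul_smul, smul_smul, mul_inv_cancel₀ hh, one_smul,
    mul_nonsing_inv _ hM]

variable {h : ℝ} {C : Matrix (Fin D) (Fin D) ℝ}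

lemma posDef_add_smul_one (hh : 0 < h) (hC : C.PosDef) :
    (C + h • (1 : Matrix (Fin D) (Fin D) ℝ)).PosDef :=
  hC.add (PosDef.one.smul hh)

/-- Rewriting the product as `(I + h C⁻¹)⁻¹` makes symmetry and positivity visible. -/
lemma posDef_inv_mul (hh : 0 < h) (hC : C.PosDef) :
    ((C + h • (1 : Matrix (Fin D) (Fin D) ℝ))⁻¹ * C).PosDef := by
  have h1 : (1 + h • C⁻¹).PosDef := PosDef.one.add (hC.inv.smul hh)
  have h2 : (C + h • (1 : Matrix (Fin D) (Fin D) ℝ))⁻¹ * C = (1 + h • C⁻¹)⁻¹ := by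
    have h3 : 1 + h • C⁻¹ = C⁻¹ * (C + h • (1 : Matrix (Fin D) (Fin D) ℝ)) := by
      rw [mul_add, nonsing_inv_mul _ (PosDef.isUnit_det hC), Matrix.mul_smul, mul_one]
    rw [h3, Matrix.mul_inv_rev, nonsing_inv_nonsing_inv _ (PosDef.isUnit_det hC)]
  rw [h2]
  exact h1.inv

/-- With `A = (C + h I)⁻¹ C` one has `I - A = h (C + h I)⁻¹`; multiplying by `C` identifies the
covariance of `auxMutation` as `h A`. -/
lemma one_sub_inv_mul_mul (hh : 0 < h) (hC : C.PosDef) :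
    (1 - (C + h • (1 : Matrix (Fin D) (Fin D) ℝ))⁻¹ * C) * C =
      h • ((C + h • (1 : Matrix (Fin D) (Fin D) ℝ))⁻¹ * C) := by
  have h1 := nonsing_inv_mul _ (PosDef.isUnit_det (posDef_add_smul_one hh hC))
  rw [mul_add, Matrix.mul_smul, mul_one] at h1
  have h2 : 1 - (C + h • (1 : Matrix (Fin D) (Fin D) ℝ))⁻¹ * C =
      h • (C + h • (1 : Matrix (Fin D) (Fin D) ℝ))⁻¹ := by
    nth_rewrite 1 [← h1]
    rw [add_sub_cancel_left]
  rw [h2, Matrix.smul_mul]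

end MatrixIdentities

end ParticleMGRAD

namespace ParticleMGRAD

/-! ### Integrating out the auxiliary variable. -/

section GaussianConvolution

variable {N D : ℕ}

/-- The normalising constant of a Gaussian density. -/
noncomputable def gaussConst {D : ℕ} (C : Matrix (Fin D) (Fin D) ℝ) : ℝ :=
  (Real.sqrt ((2 * Real.pi) ^ D * C.det))⁻¹

lemma gaussDensity_eq (m : State D) (C : Matrix (Fin D) (Fin D) ℝ) (x : State D) :
    gaussDensity m C x =
      gaussConst C * Real.exp (-(1 / 2) * ((x - m) ⬝ᵥ (C⁻¹ *ᵥ (x - m)))) := rfl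

lemma gaussConst_pos {C : Matrix (Fin D) (Fin D) ℝ} (hC : C.PosDef) : 0 < gaussConst C := by
  have := hC.det_pos
  unfold gaussConst
  positivity

variable {h : ℝ} {A : Matrix (Fin D) (Fin D) ℝ}

lemma posDef_one_add_smul (hA : A.PosDef) (N : ℕ) :
    ((1 : Matrix (Fin D) (Fin D) ℝ) + (N : ℝ) • A).PosDef :=
  PosDef.one.add_posSemidef (hA.posSemidef.smul (Nat.cast_nonneg N))

/-- The covariance `h A` matches the coefficient `A` of `u`, so the cross term is free of `A` and
each particle adds just `h⁻¹ A` to the precision in `u`. -/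
lemma quadratic_sub_mulVec (hh : 0 < h) (hA : A.PosDef) (b u : State D) :
    (b - A *ᵥ u) ⬝ᵥ ((h • A)⁻¹ *ᵥ (b - A *ᵥ u)) =
      b ⬝ᵥ ((h • A)⁻¹ *ᵥ b) - 2 * h⁻¹ * (u ⬝ᵥ b) + h⁻¹ * (u ⬝ᵥ (A *ᵥ u)) := by
  rw [quadratic_sub (PosDef.transpose_eq (hA.smul hh).inv),
    smul_inv_of_ne_zero hh.ne' (PosDef.isUnit_det hA)]
  simp only [smul_mulVec, mulVec_mulVec, Matrix.smul_mul, nonsing_inv_mul _ (PosDef.isUnit_det hA), one_mulVec,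
    dotProduct_smul, smul_eq_mul]
  rw [dotProduct_comm b u, dotProduct_comm (A *ᵥ u) u]
  ring

lemma quadratic_sub_inv_mulVec (hh : 0 < h) {B : Matrix (Fin D) (Fin D) ℝ} (hB : B.PosDef)
    (u r : State D) :
    (u - B⁻¹ *ᵥ r) ⬝ᵥ ((h • B⁻¹)⁻¹ *ᵥ (u - B⁻¹ *ᵥ r)) =
      h⁻¹ * (u ⬝ᵥ (B *ᵥ u)) - 2 * h⁻¹ * (u ⬝ᵥ r) + h⁻¹ * (r ⬝ᵥ (B⁻¹ *ᵥ r)) := by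
  rw [quadratic_sub (PosDef.transpose_eq (hB.inv.smul hh).inv),
    smul_inv_of_ne_zero hh.ne' (PosDef.isUnit_det hB.inv),
    nonsing_inv_nonsing_inv _ (PosDef.isUnit_det hB)]
  simp only [smul_mulVec, mulVec_mulVec, Matrix.smul_mul, mul_nonsing_inv _ (PosDef.isUnit_det hB), one_mulVec,
    dotProduct_smul, smul_eq_mul]
  rw [dotProduct_comm (B⁻¹ *ᵥ r) r]
  ring

/-- Completing the square in `u`: the precision is `h⁻¹ (I + N A)`, the linear term is `h⁻¹` times
`a` plus the sum of the `z m - v m`, and the exponential collects what does not depend on `u`. -/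
lemma gaussDensity_mul_prod_eq (hh : 0 < h) (hA : A.PosDef) (a u : State D)
    (v z : Particles N D) (n : Fin (N + 1)) :
    gaussDensity a (h • (1 : Matrix (Fin D) (Fin D) ℝ)) u *
      ∏ m ∈ Finset.univ.erase n, gaussDensity (v m + A *ᵥ u) (h • A) (z m) =
    gaussConst (h • (1 : Matrix (Fin D) (Fin D) ℝ)) * gaussConst (h • A) ^ N /
      gaussConst (h • (1 + (N : ℝ) • A)⁻¹) *
      Real.exp (1 / 2 * h⁻¹ * ((a + ∑ m ∈ Finset.univ.erase n, (z m - v m)) ⬝ᵥ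
        ((1 + (N : ℝ) • A)⁻¹ *ᵥ (a + ∑ m ∈ Finset.univ.erase n, (z m - v m)))) -
        1 / 2 * h⁻¹ * (a ⬝ᵥ a) - 1 / 2 * ∑ m ∈ Finset.univ.erase n,
          (z m - v m) ⬝ᵥ ((h • A)⁻¹ *ᵥ (z m - v m))) *
      gaussDensity ((1 + (N : ℝ) • A)⁻¹ *ᵥ (a + ∑ m ∈ Finset.univ.erase n, (z m - v m)))
        (h • (1 + (N : ℝ) • A)⁻¹) u := by
  have hB := posDef_one_add_smul hA N
  have hK := (gaussConst_pos (hB.inv.smul hh)).ne'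
  have hcard : (Finset.univ.erase n).card = N := by
    rw [Finset.card_erase_of_mem (Finset.mem_univ n), Finset.card_univ, Fintype.card_fin,
      Nat.add_sub_cancel]
  simp only [gaussDensity_eq, Finset.prod_mul_distrib, Finset.prod_const, hcard,
    ← Real.exp_sum]
  have hexp : ∀ K₁ K₂ K₃ e₁ e₂ e₃ e₄ : ℝ, K₃ ≠ 0 → e₁ + e₂ = e₃ + e₄ →
      K₁ * Real.exp e₁ * (K₂ * Real.exp e₂) =
        K₁ * K₂ / K₃ * Real.exp e₃ * (K₃ * Real.exp e₄) := by
    intro K₁ K₂ K₃ e₁ e₂ e₃ e₄ hK₃ he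
    calc K₁ * Real.exp e₁ * (K₂ * Real.exp e₂) = K₁ * K₂ * Real.exp (e₁ + e₂) := by
          rw [Real.exp_add]; ring
      _ = K₁ * K₂ / K₃ * Real.exp e₃ * (K₃ * Real.exp e₄) := by
          rw [he, Real.exp_add]; field_simp
  refine hexp _ _ _ _ _ _ _ hK ?_
  have h1 : (u - a) ⬝ᵥ ((h • (1 : Matrix (Fin D) (Fin D) ℝ))⁻¹ *ᵥ (u - a)) =
      h⁻¹ * (u ⬝ᵥ u) - 2 * h⁻¹ * (u ⬝ᵥ a) + h⁻¹ * (a ⬝ᵥ a) := by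
    have h2 := quadratic_sub_inv_mulVec hh (B := (1 : Matrix (Fin D) (Fin D) ℝ)) PosDef.one u a
    simpa only [inv_one, one_mulVec] using h2
  have h2 : ∀ m, z m - (v m + A *ᵥ u) = (z m - v m) - A *ᵥ u := fun m => by abel
  have h3 : u ⬝ᵥ ((1 + (N : ℝ) • A) *ᵥ u) = u ⬝ᵥ u + N * (u ⬝ᵥ (A *ᵥ u)) := by
    rw [add_mulVec, one_mulVec, smul_mulVec, dotProduct_add, dotProduct_smul, smul_eq_mul]
  simp only [h1, h2, quadratic_sub_mulVec hh hA, quadratic_sub_inv_mulVec hh hB, h3]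
  rw [← Finset.mul_sum, Finset.sum_add_distrib, Finset.sum_sub_distrib, ← Finset.mul_sum,
    ← dotProduct_sum, Finset.sum_const, hcard, nsmul_eq_mul, dotProduct_add]
  ring

lemma integral_gaussDensity_mul_prod (hh : 0 < h) (hA : A.PosDef) (a : State D)
    (v z : Particles N D) (n : Fin (N + 1)) :
    ∫ u, gaussDensity a (h • (1 : Matrix (Fin D) (Fin D) ℝ)) u *
      ∏ m ∈ Finset.univ.erase n, gaussDensity (v m + A *ᵥ u) (h • A) (z m) =
    gaussConst (h • (1 : Matrix (Fin D) (Fin D) ℝ)) * gaussConst (h • A) ^ N /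
      gaussConst (h • (1 + (N : ℝ) • A)⁻¹) *
      Real.exp (1 / 2 * h⁻¹ * ((a + ∑ m ∈ Finset.univ.erase n, (z m - v m)) ⬝ᵥ
        ((1 + (N : ℝ) • A)⁻¹ *ᵥ (a + ∑ m ∈ Finset.univ.erase n, (z m - v m)))) -
        1 / 2 * h⁻¹ * (a ⬝ᵥ a) - 1 / 2 * ∑ m ∈ Finset.univ.erase n,
          (z m - v m) ⬝ᵥ ((h • A)⁻¹ *ᵥ (z m - v m))) := by
  simp only [gaussDensity_mul_prod_eq hh hA]
  rw [integral_const_mul, integral_gaussDensity ((posDef_one_add_smul hA N).inv.smul hh), mul_one]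

lemma mul_inv_add_smul (hA : A.PosDef) (N : ℕ) :
    (1 + (N : ℝ) • A)⁻¹ + (N : ℝ) • (A * (1 + (N : ℝ) • A)⁻¹) = 1 := by
  have h1 := mul_nonsing_inv _ (PosDef.isUnit_det (posDef_one_add_smul hA N))
  rwa [add_mul, one_mul, Matrix.smul_mul] at h1

/-- The exponent of the marginal proposal density, up to a term which is symmetric in the
particles. -/
lemma exponent_eq (hA : A.PosDef) (x v φ T : State D) (R : Matrix (Fin D) (Fin D) ℝ)
    (h c : ℝ) :
    1 / 2 * h⁻¹ * (((x + φ) + (T - (x - v))) ⬝ᵥ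
        ((1 + (N : ℝ) • A)⁻¹ *ᵥ ((x + φ) + (T - (x - v))))) -
      1 / 2 * h⁻¹ * ((x + φ) ⬝ᵥ (x + φ)) - 1 / 2 * (c - (x - v) ⬝ᵥ (R *ᵥ (x - v))) =
    (1 / 2 * h⁻¹ * (T ⬝ᵥ ((1 + (N : ℝ) • A)⁻¹ *ᵥ T)) - 1 / 2 * c) +
    (1 / 2 * ((x - v) ⬝ᵥ ((R + h⁻¹ • (1 + (N : ℝ) • A)⁻¹) *ᵥ (x - v)))
      - ((N : ℝ) / 2 * ((x + φ) ⬝ᵥ ((A * (h⁻¹ • (1 + (N : ℝ) • A)⁻¹)) *ᵥ (x + φ)))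
        + (x - v) ⬝ᵥ ((h⁻¹ • (1 + (N : ℝ) • A)⁻¹) *ᵥ (x + φ)))
      + T ⬝ᵥ ((h⁻¹ • (1 + (N : ℝ) • A)⁻¹) *ᵥ (v + φ))) := by
  have hsymm := PosDef.transpose_eq (posDef_one_add_smul hA N).inv
  -- With `T` the sum over all particles, the linear term depends on the particle index only through
  -- `v + φ`.
  have h1 : (x + φ) + (T - (x - v)) = T + (v + φ) := by abel
  have h2 : v + φ = (x + φ) - (x - v) := by abel
  -- Splitting the identity as `(I + N A)⁻¹ + N A (I + N A)⁻¹` produces the term with factor `N /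
  -- 2`.
  have h3 : (x + φ) ⬝ᵥ (x + φ) = (x + φ) ⬝ᵥ ((1 + (N : ℝ) • A)⁻¹ *ᵥ (x + φ)) +
      N * ((x + φ) ⬝ᵥ ((A * (1 + (N : ℝ) • A)⁻¹) *ᵥ (x + φ))) := by
    have h4 := congrArg (fun M => (x + φ) ⬝ᵥ (M *ᵥ (x + φ))) (mul_inv_add_smul hA N)
    simp only [add_mulVec, smul_mulVec, dotProduct_add, dotProduct_smul, smul_eq_mul,
      one_mulVec] at h4
    simp only [dotProduct_add]
    linarith
  rw [h1, quadratic_add hsymm, h2, h3, quadratic_sub hsymm,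
    dotProduct_mulVec_symm hsymm (x + φ) (x - v)]
  simp only [Matrix.mul_smul, add_mulVec (R), smul_mulVec, dotProduct_smul, smul_eq_mul]
  rw [dotProduct_add ((x - v)) (R *ᵥ _), dotProduct_smul, smul_eq_mul]
  ring

end GaussianConvolution

/-! ### Measurability of gradients depending on a parameter. -/

section Drift

variable {D : ℕ}

/-- Each partial derivative is the pointwise limit of difference quotients with increments `1 / (n +
1)`, which are jointly measurable. -/
lemma measurable_grad_param {α : Type*} [MeasurableSpace α] {f : α → State D → ℝ}
    (hf : Measurable fun p : α × State D => f p.1 p.2)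
    (hd : ∀ a, Differentiable ℝ (f a)) :
    Measurable fun p : α × State D => grad (f p.1) p.2 := by
  refine measurable_pi_iff.2 fun j => ?_
  have hlim : Filter.Tendsto (fun n : ℕ => 1 / ((n : ℝ) + 1)) Filter.atTop
      (nhdsWithin 0 (Set.Ioi 0)) :=
    tendsto_nhdsWithin_iff.2 ⟨tendsto_one_div_add_atTop_nhds_zero_nat,
      Filter.Eventually.of_forall fun n => by
        have : (0 : ℝ) < 1 / ((n : ℝ) + 1) := by positivity
        exact this⟩
  refine measurable_of_tendsto_metrizable
    (f := fun (n : ℕ) (p : α × State D) => (1 / ((n : ℝ) + 1))⁻¹ *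
      (f p.1 (p.2 + (1 / ((n : ℝ) + 1)) • (Pi.single j 1 : State D)) - f p.1 p.2)) ?_ ?_
  · intro n
    have h1 : Measurable fun p : α × State D =>
      (p.1, p.2 + (1 / ((n : ℝ) + 1)) • (Pi.single j 1 : State D)) := by fun_prop
    exact ((hf.fun_comp h1).sub hf).const_mul _
  · rw [tendsto_pi_nhds]
    intro p
    have h1 := ((hd p.1).differentiableAt (x := p.2)).hasFDerivAt.hasLineDerivAt
      (Pi.single j 1 : State D)
    have h2 := h1.tendsto_slope_zero_right.comp hlim
    simpa only [Function.comp_def, smul_eq_mul, grad] using h2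

end Drift

end ParticleMGRAD

namespace ParticleMGRAD

namespace Model

/-! ### Positivity and measurability of the model. -/

section Regularity

variable {S D : ℕ} (𝓜 : Model S D)

lemma measurable_mean (hm : ∀ s, Measurable (𝓜.m s)) (t : Fin (S + 1)) :
    Measurable (𝓜.mean t) := by
  cases t using Fin.cases with
  | zero => exact measurable_const
  | succ s => exact hm s

lemma pot_pos (hG₁ : ∀ x, 0 < 𝓜.G₁ x) (hG : ∀ s xp x, 0 < 𝓜.G s xp x) (t : Fin (S + 1))
    (xp x : State D) : 0 < 𝓜.pot t xp x := by
  cases t using Fin.cases with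
  | zero => exact hG₁ x
  | succ s => exact hG s xp x

lemma differentiable_pot (hG₁ : Differentiable ℝ 𝓜.G₁)
    (hG : ∀ s xp, Differentiable ℝ (𝓜.G s xp)) (t : Fin (S + 1)) (xp : State D) :
    Differentiable ℝ (𝓜.pot t xp) := by
  cases t using Fin.cases with
  | zero => exact hG₁
  | succ s => exact hG s xp

lemma measurable_pot (hG₁ : Measurable 𝓜.G₁) (hG : ∀ s, Measurable (Function.uncurry (𝓜.G s)))
    (t : Fin (S + 1)) : Measurable fun p : State D × State D => 𝓜.pot t p.1 p.2 := by
  cases t using Fin.cases with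
  | zero => exact hG₁.fun_comp measurable_snd
  | succ s => exact hG s

lemma Q_pos (hC : ∀ t, (𝓜.C t).PosDef) (hpos : ∀ t xp x, 0 < 𝓜.pot t xp x) (t : Fin (S + 1))
    (xp x : State D) : 0 < 𝓜.Q t xp x :=
  mul_pos (gaussDensity_pos (hC t) _ _) (hpos t xp x)

lemma measurable_Q (hm : ∀ t, Measurable (𝓜.mean t))
    (hpot : ∀ t, Measurable fun p : State D × State D => 𝓜.pot t p.1 p.2) (t : Fin (S + 1)) :
    Measurable fun p : State D × State D => 𝓜.Q t p.1 p.2 := by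
  unfold Q
  exact (measurable_gaussDensity_comp _ ((hm t).fun_comp measurable_fst) measurable_snd).mul
    (hpot t)

lemma measurable_drift (κ : ℝ) (δ : Fin (S + 1) → ℝ)
    (hpot : ∀ t, Measurable fun p : State D × State D => 𝓜.pot t p.1 p.2)
    (hpos : ∀ t xp x, 0 < 𝓜.pot t xp x) (hd : ∀ t xp, Differentiable ℝ (𝓜.pot t xp))
    (t : Fin (S + 1)) : Measurable fun p : State D × State D => 𝓜.drift κ δ t p.1 p.2 := by
  unfold drift
  have h := measurable_grad_param (f := fun xp x => Real.log (𝓜.pot t xp x)) (hpot t).log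
    fun xp => (hd t xp).log fun x => (hpos t xp x).ne'
  exact h.const_smul (κ * (δ t / 2))

lemma measurable_shift (δ : Fin (S + 1) → ℝ) (hm : ∀ t, Measurable (𝓜.mean t))
    (t : Fin (S + 1)) : Measurable (𝓜.shift δ t) := by
  unfold shift
  exact measurable_mulVec _ (hm t)

end Regularity

/-! ### Particle-mGRAD as a generic marginal algorithm. -/

section Weights

variable {S N D : ℕ} (𝓜 : Model S D) (κ : ℝ) (δ : Fin (S + 1) → ℝ)

lemma posDef_A (hδ : ∀ t, 0 < δ t) (hC : ∀ t, (𝓜.C t).PosDef) (t : Fin (S + 1)) :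
    (𝓜.A δ t).PosDef :=
  posDef_inv_mul (half_pos (hδ t)) (hC t)

/-- The means agree since `m + A (u - m) = (I - A) m + A u`, and the covariances since `(I - A) C =
(δ / 2) A`. -/
theorem mgradProposal_eq (hδ : ∀ t, 0 < δ t) (hC : ∀ t, (𝓜.C t).PosDef) :
    𝓜.mgradProposal (N := N) κ δ =
      genericProposal (𝓜.drift κ δ) (𝓜.shift δ) (𝓜.A δ) (fun t => (δ t / 2) • 𝓜.A δ t)
        (fun t => (δ t / 2) • (1 : Matrix (Fin D) (Fin D) ℝ)) := by
  funext t k y z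
  have h : ∀ (n : Fin (N + 1)) u, 𝓜.auxMutation δ t (y n) u (z n) =
      gaussDensity (𝓜.shift δ t (y n) + 𝓜.A δ t *ᵥ u) ((δ t / 2) • 𝓜.A δ t) (z n) := by
    intro n u
    have h1 : (1 - 𝓜.A δ t) * 𝓜.C t = (δ t / 2) • 𝓜.A δ t :=
      one_sub_inv_mul_mul (half_pos (hδ t)) (hC t)
    have h2 : 𝓜.mean t (y n) + 𝓜.A δ t *ᵥ (u - 𝓜.mean t (y n)) =
        𝓜.shift δ t (y n) + 𝓜.A δ t *ᵥ u := by
      rw [shift, sub_mulVec, one_mulVec, mulVec_sub]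
      abel
    rw [auxMutation, h1, h2]
  simp only [mgradProposal, genericProposal, h]

lemma smul_average_sub (z v : Particles N D) :
    ((N : ℝ) + 1) • (average z - average v) = ∑ m, (z m - v m) := by
  have h : (N : ℝ) + 1 ≠ 0 := by positivity
  rw [average, average, ← smul_sub, smul_smul, mul_one_div_cancel h, one_smul,
    Finset.sum_sub_distrib]

/-- The factor by which the weights of the generic marginal algorithm differ from those of
Particle-mGRAD. -/
noncomputable def weightRatio (t : Fin (S + 1)) (y z : Particles N D) : ℝ :=
  gaussConst ((δ t / 2) • (1 : Matrix (Fin D) (Fin D) ℝ)) *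
      gaussConst ((δ t / 2) • 𝓜.A δ t) ^ N /
    gaussConst ((δ t / 2) • (1 + (N : ℝ) • 𝓜.A δ t)⁻¹) *
    Real.exp (1 / 2 * (δ t / 2)⁻¹ * ((∑ m, (z m - 𝓜.shift δ t (y m))) ⬝ᵥ
      ((1 + (N : ℝ) • 𝓜.A δ t)⁻¹ *ᵥ (∑ m, (z m - 𝓜.shift δ t (y m))))) -
      1 / 2 * ∑ m, (z m - 𝓜.shift δ t (y m)) ⬝ᵥ
        (((δ t / 2) • 𝓜.A δ t)⁻¹ *ᵥ (z m - 𝓜.shift δ t (y m))))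

lemma weightRatio_pos (hδ : ∀ t, 0 < δ t) (hC : ∀ t, (𝓜.C t).PosDef) (t : Fin (S + 1))
    (y z : Particles N D) : 0 < 𝓜.weightRatio δ t y z := by
  have hA := 𝓜.posDef_A δ hδ hC t
  have hh := half_pos (hδ t)
  have h1 := gaussConst_pos (C := (δ t / 2) • (1 : Matrix (Fin D) (Fin D) ℝ)) (PosDef.one.smul hh)
  have h2 := gaussConst_pos (hA.smul hh)
  have h3 := gaussConst_pos ((posDef_one_add_smul hA N).inv.smul hh)
  unfold weightRatio
  positivity

/-- The proposal density is evaluated in closed form, and sums over particles other than `n` are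
written as full sums minus the term of `n`. Full sums are common to all particles; in the cross term
the full sum is `N + 1` times the difference of averages. -/
theorem genericWeight_eq (hδ : ∀ t, 0 < δ t) (hC : ∀ t, (𝓜.C t).PosDef) (t : Fin (S + 1))
    (y z : Particles N D) (n : Fin (N + 1)) :
    genericWeight 𝓜.Q (𝓜.drift κ δ) (𝓜.shift δ) (𝓜.A δ) (fun t => (δ t / 2) • 𝓜.A δ t)
      (fun t => (δ t / 2) • (1 : Matrix (Fin D) (Fin D) ℝ)) t y z n =
      𝓜.weightRatio δ t y z * 𝓜.mgradWeight κ δ t y z n := by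
  have hA := 𝓜.posDef_A δ hδ hC t
  have hinv : (δ t / 2)⁻¹ = 2 / δ t := inv_div _ _
  have hsum : ∑ m ∈ Finset.univ.erase n, (z m - 𝓜.shift δ t (y m)) =
      ∑ m, (z m - 𝓜.shift δ t (y m)) - (z n - 𝓜.shift δ t (y n)) :=
    Finset.sum_erase_eq_sub (Finset.mem_univ n)
  have hsum' : ∑ m ∈ Finset.univ.erase n, (z m - 𝓜.shift δ t (y m)) ⬝ᵥ
        (((δ t / 2) • 𝓜.A δ t)⁻¹ *ᵥ (z m - 𝓜.shift δ t (y m))) =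
      ∑ m, (z m - 𝓜.shift δ t (y m)) ⬝ᵥ
        (((δ t / 2) • 𝓜.A δ t)⁻¹ *ᵥ (z m - 𝓜.shift δ t (y m))) -
      (z n - 𝓜.shift δ t (y n)) ⬝ᵥ
        (((δ t / 2) • 𝓜.A δ t)⁻¹ *ᵥ (z n - 𝓜.shift δ t (y n))) :=
    Finset.sum_erase_eq_sub (Finset.mem_univ n)
  rw [genericWeight, genericProposal, mgradWeight,
    integral_gaussDensity_mul_prod (half_pos (hδ t)) hA _ (fun m => 𝓜.shift δ t (y m)),
    hsum, hsum', exponent_eq hA, Real.exp_add, logWeightFactor, weightRatio, weightMatrix,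
    ← smul_eq_mul ((N : ℝ) + 1), ← smul_dotProduct, smul_average_sub, hinv]
  ring

lemma normalise_const_mul {c : ℝ} (hc : c ≠ 0) (w : Fin (N + 1) → ℝ) :
    normalise (fun n => c * w n) = normalise w := by
  funext n
  rw [normalise, normalise, ← Finset.mul_sum, mul_div_mul_left _ _ hc]

/-- Weights enter the joint density only after normalisation, which cancels `weightRatio`. -/
theorem mgradLaw_eq (hδ : ∀ t, 0 < δ t) (hC : ∀ t, (𝓜.C t).PosDef) (x : Path S D) :
    𝓜.mgradLaw κ δ N x = genericLaw N 𝓜.Q (𝓜.drift κ δ) (𝓜.shift δ) (𝓜.A δ)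
      (fun t => (δ t / 2) • 𝓜.A δ t)
      (fun t => (δ t / 2) • (1 : Matrix (Fin D) (Fin D) ℝ)) x := by
  have h : ∀ (t : Fin (S + 1)) (y z : Particles N D),
      normalise (𝓜.mgradWeight κ δ t y z) =
      normalise (genericWeight 𝓜.Q (𝓜.drift κ δ) (𝓜.shift δ) (𝓜.A δ)
        (fun t => (δ t / 2) • 𝓜.A δ t)
        (fun t => (δ t / 2) • (1 : Matrix (Fin D) (Fin D) ℝ)) t y z) := by
    intro t y z
    rw [funext (𝓜.genericWeight_eq κ δ hδ hC t y z),
      normalise_const_mul (𝓜.weightRatio_pos δ hδ hC t y z).ne']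
  simp only [mgradLaw, genericLaw, csmcLaw, jointDensity, 𝓜.mgradProposal_eq κ δ hδ hC, h]

end Weights

/-! ### The normalised target. -/

section Target

variable {S D : ℕ} (𝓜 : Model S D)

theorem isProbabilityMeasure_target (hQ : ∀ t y x, 0 < 𝓜.Q t y x)
    (hQm : ∀ t, Measurable fun p : State D × State D => 𝓜.Q t p.1 p.2)
    (hZ : 𝓜.normConst ≠ ⊤) : IsProbabilityMeasure 𝓜.target := by
  have hm : Measurable fun x : Path S D => ENNReal.ofReal (𝓜.targetDensity x) :=
    (measurable_pathDensity hQm).ennreal_ofReal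
  have hpos : ∀ x : Path S D, 0 < 𝓜.targetDensity x := fun x =>
    Finset.prod_pos fun t _ => hQ t _ _
  -- Only finiteness has to be assumed: an everywhere positive density has positive integral.
  have h0 : 𝓜.normConst ≠ 0 := by
    unfold normConst
    rw [← pos_iff_ne_zero, lintegral_pos_iff_support hm, Set.eq_univ_of_forall fun x =>
      Function.mem_support.2 (ENNReal.ofReal_pos.2 (hpos x)).ne']
    exact Measure.measure_univ_pos.2 (NeZero.ne _)
  constructor
  rw [target, Measure.smul_apply, withDensity_apply _ MeasurableSet.univ, Measure.restrict_univ,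
    smul_eq_mul]
  exact ENNReal.inv_mul_cancel h0 hZ

end Target

end Model

end ParticleMGRAD

theorem mainTheorem6 (S N D : ℕ) (hN : 1 ≤ N) (𝓜 : ParticleMGRAD.Model S D)
    (κ : ℝ) (hκ : κ = 0 ∨ κ = 1) (δ : Fin (S + 1) → ℝ) (hδ : ∀ t, 0 < δ t)
    (hC : ∀ t, (𝓜.C t).PosDef)
    (hm : ∀ s, Measurable (𝓜.m s))
    (hG₁_pos : ∀ x, 0 < 𝓜.G₁ x) (hG₁_diff : Differentiable ℝ 𝓜.G₁)
    (hG_pos : ∀ s xp x, 0 < 𝓜.G s xp x)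
    (hG_meas : ∀ s, Measurable (Function.uncurry (𝓜.G s)))
    (hG_diff : ∀ s xp, Differentiable ℝ (𝓜.G s xp))
    (hZ : 𝓜.normConst ≠ ⊤) :
    MeasureTheory.IsProbabilityMeasure 𝓜.target ∧
    -- the algorithm induces a Markov kernel that leaves the target invariant
    (∃ P : ProbabilityTheory.Kernel (ParticleMGRAD.Path S D) (ParticleMGRAD.Path S D),
      ProbabilityTheory.IsMarkovKernel P ∧ (∀ x, P x = 𝓜.mgradLaw κ δ N x) ∧
        P.Invariant 𝓜.target) ∧
    -- its proposals are those of the generic marginal algorithm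
    (∀ (t : Fin (S + 1)) (k : Fin (N + 1)) (y z : ParticleMGRAD.Particles N D),
      𝓜.mgradProposal κ δ t k y z =
        ParticleMGRAD.genericProposal (𝓜.drift κ δ) (𝓜.shift δ) (𝓜.A δ)
          (fun t => (δ t / 2) • 𝓜.A δ t) (fun t => (δ t / 2) • (1 : Matrix (Fin D) (Fin D) ℝ)) t k y z) ∧
    -- its weights are proportional to those of the generic marginal algorithm
    (∀ (t : Fin (S + 1)) (y z : ParticleMGRAD.Particles N D), ∃ c : ℝ, 0 < c ∧
      ∀ n : Fin (N + 1),
        ParticleMGRAD.genericWeight 𝓜.Q (𝓜.drift κ δ) (𝓜.shift δ) (𝓜.A δ)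
          (fun t => (δ t / 2) • 𝓜.A δ t) (fun t => (δ t / 2) • (1 : Matrix (Fin D) (Fin D) ℝ)) t y z n =
        c * 𝓜.mgradWeight κ δ t y z n) ∧
    -- hence both algorithms have the same law
    (∀ x, 𝓜.mgradLaw κ δ N x =
      ParticleMGRAD.genericLaw N 𝓜.Q (𝓜.drift κ δ) (𝓜.shift δ) (𝓜.A δ)
        (fun t => (δ t / 2) • 𝓜.A δ t) (fun t => (δ t / 2) • (1 : Matrix (Fin D) (Fin D) ℝ)) x) := by
  have hpos := 𝓜.pot_pos hG₁_pos hG_pos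
  have hpot := 𝓜.measurable_pot hG₁_diff.continuous.measurable hG_meas
  have hmean := 𝓜.measurable_mean hm
  have hQ := 𝓜.Q_pos hC hpos
  have hQm := 𝓜.measurable_Q hmean hpot
  have hdrift := 𝓜.measurable_drift κ δ hpot hpos (𝓜.differentiable_pot hG₁_diff hG_diff)
  have hscheme := ParticleMGRAD.isMarginalScheme_generic (N := N) (H := 𝓜.A δ) hQ hQm hdrift
    (𝓜.measurable_shift δ hmean) (Dm := fun t => (δ t / 2) • 𝓜.A δ t)
    (E := fun t => (δ t / 2) • (1 : Matrix (Fin D) (Fin D) ℝ))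
    (fun t => (𝓜.posDef_A δ hδ hC t).smul (half_pos (hδ t)))
    (fun t => Matrix.PosDef.one.smul (half_pos (hδ t)))
  -- The kernel is that of the generic scheme. `target` is definitionally a multiple of the measure
  -- with density `pathDensity`, so `invariant_kernel` applies with the inverse normalising
  -- constant.
  refine ⟨𝓜.isProbabilityMeasure_target hQ hQm hZ,
    ⟨hscheme.kernel, ⟨hscheme.isProbabilityMeasure_csmcLaw hN⟩,
      fun x => (𝓜.mgradLaw_eq κ δ hδ hC x).symm, hscheme.invariant_kernel hN _⟩,
    fun t k y z => by rw [𝓜.mgradProposal_eq κ δ hδ hC],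
    fun t y z => ⟨_, 𝓜.weightRatio_pos δ hδ hC t y z, 𝓜.genericWeight_eq κ δ hδ hC t y z⟩,
    𝓜.mgradLaw_eq κ δ hδ hC⟩
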